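/- Let $n\ge 1$ and let $D=G/K\subset\mathbb C^n$ be a bounded symmetric domain: a bounded domain on which the group $G=\mathrm{Aut}(D)$ of biholomorphic self-maps acts transitively and such that every point of $D$ is an isolated fixed point of an involution in $G$. Let $J(g,z)$ be the complex Jacobian determinant of $g\in G$ at $z\in D$, let $dV_e$ be the Euclidean volume, let $\mathcal K(z,w)$ be the Bergman kernel of $D$ (the Hermitian reproducing kernel of the space of holomorphic functions on $D$ that are square integrable with respect to $dV_e$), and put $dV(z)=\mathcal K(z,z)\,dV_e(z)$. For a positive integer $k$ let $c(D,k)$ be the constant determined by $$c(D,k)\int_D\frac{\mathcal K(z,w)^k\,\mathcal K(w,z)^k}{\mathcal K(w,w)^k}\,dV(w)=\mathcal K(z,z)^k\qquad(z\in D).$$ Let $\Gamma$ be a discrete subgroup of $G$ (for the compact-open topology) such that $\Gamma\backslash D$ is compact and smooth, that is, $\Gamma$ acts freely on $D$. Let $m$ be a positive integer and $\rho:\Gamma\to U(m)$ a unitary representation. Let $\mathcal A(\Gamma,m,k,\rho)$ be the space of holomorphic maps $F:D\to\mathbb C^m$ with $J(\gamma,z)^kF(\gamma z)=\rho(\gamma)F(z)$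 for all $\gamma\in\Gamma$, $z\in D$, with the Petersson inner product $$(F,G)=\int_{\Gamma\backslash D}F(z)^T\,\overline{G(z)}\,\mathcal K(z,z)^{-k}\,dV(z),$$ the integral being taken over any measurable fundamental domain of $\Gamma$ in $D$. For $p\in D$ and $j\in\{1,\dots,m\}$ let $\mathcal T_p(z)\in\mathbb C^m$ be the vector whose $j$-th component is $\mathcal K(z,p)^k$ and whose other components are $0$, and consider the series $$\Theta_p^{(j;k)}(z)=c(D,k)\sum_{\gamma\in\Gamma}\rho(\gamma^{-1})\,\mathcal T_p(\gamma z)\,J(\gamma,z)^k .$$ Then there is $k_0$ such that for all integers $k\ge k_0$, all $j\in\{1,\dots,m\}$ and all $p\in D$: (i) the series $\Theta_p^{(j;k)}$ converges absolutely and uniformly on compact subsets of $D$ (the series of norms also converges uniformly there); (ii) $\Theta_p^{(j;k)}\in\mathcal A(\Gamma,m,k,\rho)$, and for every $H=(H_1,\dots,H_m)^T\in\mathcal A(\Gamma,m,k,\rho)$ the integral that defines $(H,\Theta_p^{(j;k)})$ converges absolutely and $$(H,\Theta_p^{(j;k)})=H_j(p).$$ -/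

import Mathlib

open MeasureTheory

namespace PoincareSeries

/-- A function `f : D → F` on a (usually open) subset `D` of `ℂⁿ` is holomorphic. Differentiability
is tested on the extension of `f` by zero, within `D`. -/
def IsHolomorphic {n : ℕ} {D : Set (Fin n → ℂ)} {F : Type*} [NormedAddCommGroup F]
    [NormedSpace ℂ F] (f : D → F) : Prop :=
  DifferentiableOn ℂ (Function.extend Subtype.val f 0) D

section helpers

set_option linter.unusedSectionVars false

variable {n : ℕ} {D : Set (Fin n → ℂ)} {F : Type*} [NormedAddCommGroup F] [NormedSpace ℂ F]

theorem extend_coe (f : D → F) (z : D) :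
    Function.extend Subtype.val f 0 (z : Fin n → ℂ) = f z :=
  Subtype.val_injective.extend_apply f 0 z

theorem isHolomorphic_of_eqOn {f : D → F} {u : (Fin n → ℂ) → F} (hu : DifferentiableOn ℂ u D)
    (h : ∀ z : D, f z = u z) : IsHolomorphic f :=
  hu.congr fun z hz => (extend_coe f ⟨z, hz⟩).trans (h ⟨z, hz⟩)

theorem IsHolomorphic.continuous {f : D → F} (hf : IsHolomorphic f) : Continuous f := by
  have h := continuousOn_iff_continuous_domRestrict.1 (DifferentiableOn.continuousOn hf)
  exact h.congr fun z => extend_coe f z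

theorem IsHolomorphic.comp_val {f : D → F} (hf : IsHolomorphic f) {g : D → D}
    (hg : IsHolomorphic fun z => (g z : Fin n → ℂ)) : IsHolomorphic fun z => f (g z) := by
  refine isHolomorphic_of_eqOn (DifferentiableOn.comp hf hg ?_) ?_
  · intro z hz
    rw [extend_coe (fun z : D => (g z : Fin n → ℂ)) ⟨z, hz⟩]
    exact (g ⟨z, hz⟩).2
  · intro z
    simp only [Function.comp_apply]
    rw [extend_coe (fun z : D => (g z : Fin n → ℂ)) z, extend_coe]

end helpers

/-- The group `Aut(D)` of biholomorphic self-maps of `D`. -/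
def Aut {n : ℕ} (D : Set (Fin n → ℂ)) : Subgroup (Equiv.Perm D) where
  carrier := {g | IsHolomorphic (fun z : D => ((g z : D) : Fin n → ℂ)) ∧
    IsHolomorphic (fun z : D => ((g⁻¹ z : D) : Fin n → ℂ))}
  one_mem' := by
    constructor <;>
    · refine isHolomorphic_of_eqOn (u := id) differentiableOn_id ?_
      intro z
      simp
  mul_mem' := by
    rintro a b ⟨ha, ha'⟩ ⟨hb, hb'⟩
    refine ⟨ha.comp_val hb, ?_⟩
    have h := hb'.comp_val ha'
    simpa only [mul_inv_rev, Equiv.Perm.mul_apply] using h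
  inv_mem' := by
    rintro a ⟨ha, ha'⟩
    exact ⟨ha', by simpa using ha⟩

/-- The element `g` of `Aut(D)` as a continuous map `D → D`. -/
noncomputable def Aut.toContinuousMap {n : ℕ} {D : Set (Fin n → ℂ)} (g : Aut D) : C(D, D) where
  toFun z := g • z
  continuous_toFun := Continuous.subtype_mk (IsHolomorphic.continuous g.2.1) _

/-- `Aut(D)` carries the compact-open topology. -/
noncomputable instance {n : ℕ} (D : Set (Fin n → ℂ)) : TopologicalSpace (Aut D) :=
  TopologicalSpace.induced Aut.toContinuousMap inferInstance

/-- A bounded symmetric domain `D = G/K ⊂ ℂⁿ`: a bounded domain on which `G = Aut(D)` acts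
transitively and each of whose points is an isolated fixed point of an involution in `Aut(D)`. -/
structure IsBoundedSymmetricDomain {n : ℕ} (D : Set (Fin n → ℂ)) : Prop where
  isOpen : IsOpen D
  isConnected : IsConnected D
  isBounded : Bornology.IsBounded D
  transitive : ∀ z w : D, ∃ g : Aut D, g • z = w
  symmetric : ∀ p : D, ∃ s : Aut D, s * s = 1 ∧ s • p = p ∧
    ∀ᶠ z in nhds p, s • z = z → z = p

/-- `Γ` is a discrete subgroup of `Aut(D)` such that `Γ \ D` is compact and smooth, i.e. `Γ` acts
without fixed points, so that `D → Γ \ D` is a covering. -/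
structure IsSmoothCocompactLattice {n : ℕ} {D : Set (Fin n → ℂ)} (Γ : Subgroup (Aut D)) :
    Prop where
  discrete : DiscreteTopology Γ
  free : ∀ (γ : Γ) (z : D), γ • z = z → γ = 1
  compact : CompactSpace (MulAction.orbitRel.Quotient Γ D)

/-- The complex Jacobian `J(g, z)` of `g : D → D` at `z`. -/
noncomputable def jacobian {n : ℕ} {D : Set (Fin n → ℂ)} (g : Aut D) (z : D) : ℂ :=
  (fderiv ℂ (Function.extend Subtype.val (fun w : D => ((g • w : D) : Fin n → ℂ)) 0)
    (z : Fin n → ℂ)).det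

/-- The Euclidean volume `dV_e` on `D`. -/
noncomputable def eucVolume {n : ℕ} (D : Set (Fin n → ℂ)) : Measure D :=
  (volume : Measure (Fin n → ℂ)).comap Subtype.val

/-- Holomorphic functions on `D`, square integrable for the Euclidean volume `dV_e`. -/
def IsBergmanFunction {n : ℕ} {D : Set (Fin n → ℂ)} (f : D → ℂ) : Prop :=
  IsHolomorphic f ∧ MemLp f 2 (eucVolume D)

/-- `K` is a Hermitian reproducing kernel of the space of square integrable holomorphic functions
on `D`. There is at most one such `K` (see `IsBergmanKernel.unique`). -/
structure IsBergmanKernel {n : ℕ} (D : Set (Fin n → ℂ)) (K : D → D → ℂ) : Prop where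
  mem : ∀ w : D, IsBergmanFunction fun z => K z w
  hermitian : ∀ z w : D, K z w = star (K w z)
  reproducing : ∀ f : D → ℂ, IsBergmanFunction f → ∀ z : D, f z = ∫ w : D, f w * K z w ∂(eucVolume D)

theorem IsBergmanKernel.unique {n : ℕ} {D : Set (Fin n → ℂ)} {K L : D → D → ℂ}
    (hK : IsBergmanKernel D K) (hL : IsBergmanKernel D L) : K = L := by
  funext z w
  have h1 := hL.reproducing _ (hK.mem w) z
  have h2 := hK.reproducing _ (hL.mem z) w
  rw [h1, hL.hermitian z w, h2]
  simp only [RCLike.star_def]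
  rw [← integral_conj]
  congr 1
  funext u
  rw [map_mul, hL.hermitian z u, hK.hermitian u w]
  simp [mul_comm]

open Classical in
/-- The Bergman kernel `𝒦` of `D`. -/
noncomputable def bergmanKernel {n : ℕ} (D : Set (Fin n → ℂ)) : D → D → ℂ :=
  if h : ∃ K, IsBergmanKernel D K then h.choose else 0

/-- The invariant volume `dV(z) = 𝒦(z,z) dV_e(z)` on `D`. -/
noncomputable def invVolume {n : ℕ} (D : Set (Fin n → ℂ)) : Measure D :=
  (eucVolume D).withDensity fun z => ENNReal.ofReal (bergmanKernel D z z).re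

open Classical in
/-- The constant `c(D,k)`, determined by
`c(D,k) ∫_D 𝒦(z,w)^k 𝒦(w,z)^k / 𝒦(w,w)^k dV(w) = 𝒦(z,z)^k` for all `z ∈ D`. -/
noncomputable def bergmanConst {n : ℕ} (D : Set (Fin n → ℂ)) (k : ℕ) : ℝ :=
  if h : ∃ c : ℝ, ∀ z : D,
      (c : ℂ) * ∫ w : D, bergmanKernel D z w ^ k * bergmanKernel D w z ^ k /
        bergmanKernel D w w ^ k ∂(invVolume D) = bergmanKernel D z z ^ k
  then h.choose else 0

/-- The space `𝒜(Γ,m,k,ρ)` of holomorphic `F : D → ℂᵐ` such that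
`J(γ,z)^k F(γz) = ρ(γ) F(z)` for all `γ ∈ Γ`, `z ∈ D`. -/
def automorphicForms {n m : ℕ} {D : Set (Fin n → ℂ)} (Γ : Subgroup (Aut D)) (k : ℕ)
    (ρ : Γ →* Matrix.unitaryGroup (Fin m) ℂ) : Submodule ℂ (D → Fin m → ℂ) where
  carrier := {F | IsHolomorphic F ∧ ∀ (γ : Γ) (z : D),
    jacobian (γ : Aut D) z ^ k • F (γ • z) =
      (ρ γ : Matrix (Fin m) (Fin m) ℂ).mulVec (F z)}
  add_mem' := by
    rintro F G ⟨hF, hF'⟩ ⟨hG, hG'⟩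
    refine ⟨isHolomorphic_of_eqOn (DifferentiableOn.add hF hG) fun z => ?_, fun γ z => ?_⟩
    · simp only [Pi.add_apply, extend_coe]
    · simp only [Pi.add_apply, smul_add, hF', hG', Matrix.mulVec_add]
  zero_mem' := by
    refine ⟨isHolomorphic_of_eqOn (u := 0) (differentiableOn_const 0) fun z => rfl, fun γ z => ?_⟩
    simp
  smul_mem' := by
    rintro a F ⟨hF, hF'⟩
    refine ⟨isHolomorphic_of_eqOn (DifferentiableOn.const_smul hF a) fun z => ?_, fun γ z => ?_⟩
    · simp only [Pi.smul_apply, extend_coe]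
    · rw [Pi.smul_apply, Pi.smul_apply, smul_comm, hF', Matrix.mulVec_smul]

/-- The function `F(z)ᵀ \overline{G(z)} 𝒦(z,z)^{-k}`. -/
noncomputable def peterssonDensity {n m : ℕ} {D : Set (Fin n → ℂ)} (k : ℕ)
    (F G : D → Fin m → ℂ) (z : D) : ℂ :=
  dotProduct (F z) (star (G z)) * (bergmanKernel D z z ^ k)⁻¹

/-- The Petersson inner product `(F, G) = ∫_{Γ \ D} F(z)ᵀ \overline{G(z)} 𝒦(z,z)^{-k} dV(z)`,
computed on a fundamental domain `𝓕` of `Γ`. -/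
noncomputable def petersson {n m : ℕ} {D : Set (Fin n → ℂ)} (𝓕 : Set D) (k : ℕ)
    (F G : D → Fin m → ℂ) : ℂ :=
  ∫ z in 𝓕, peterssonDensity k F G z ∂(invVolume D)

/-- The vector `𝒯_p(z) ∈ ℂᵐ` with `j`-th component `𝒦(z,p)^k` and all other components zero. -/
noncomputable def seed {n m : ℕ} {D : Set (Fin n → ℂ)} (k : ℕ) (j : Fin m) (p z : D) :
    Fin m → ℂ :=
  Pi.single j (bergmanKernel D z p ^ k)

/-- The term `c(D,k) ρ(γ⁻¹) 𝒯_p(γz) J(γ,z)^k` of the Poincaré series. -/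
noncomputable def poincareTerm {n m : ℕ} {D : Set (Fin n → ℂ)} {Γ : Subgroup (Aut D)} (k : ℕ)
    (ρ : Γ →* Matrix.unitaryGroup (Fin m) ℂ) (j : Fin m) (p : D) (γ : Γ) (z : D) :
    Fin m → ℂ :=
  ((bergmanConst D k : ℂ) * jacobian (γ : Aut D) z ^ k) •
    (ρ γ⁻¹ : Matrix (Fin m) (Fin m) ℂ).mulVec (seed k j p (γ • z))

/-- The Poincaré series `Θ_p^{(j;k)}(z) = c(D,k) ∑_γ ρ(γ⁻¹) 𝒯_p(γz) J(γ,z)^k`. -/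
noncomputable def poincareSeries {n m : ℕ} {D : Set (Fin n → ℂ)} {Γ : Subgroup (Aut D)} (k : ℕ)
    (ρ : Γ →* Matrix.unitaryGroup (Fin m) ℂ) (j : Fin m) (p z : D) : Fin m → ℂ :=
  ∑' γ : Γ, poincareTerm k ρ j p γ z

end PoincareSeries

/-! The proof unfolds the Petersson product: summing over Γ turns the integral over a fundamental
domain into one over D, which a reproducing formula for 𝒦^k evaluates at p. The threshold k ≥ 2
suffices.

The weighted Bergman space for 𝒦(z,z)^{-k} dV has a reproducing kernel L by Riesz representation.
Uniqueness of L and the change of variables formula give it the same transformation law as 𝒦^k.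
Since Aut(D) is transitive, L(z,z) = c 𝒦(z,z)^k, and polarization (`eq_zero_of_diag_eq_zero`)
extends this off the diagonal. This identifies c with c(D,k) (`isReproducingKernel_bergmanConst`).

The series converges because mean values bound |𝒦(γz,p) J(γ,z)|² by the L² mass of 𝒦(·,p) on
translates γA' of a compact set, and these overlap boundedly (`exists_summable_norm_slash_sq_le`).
Two of the k factors are summed; the others are bounded.

The main obstacle is that an automorphic form H need not be square integrable over D. Cocompactness
only gives |H_j|² ≤ M 𝒦(w,w)^k. Let β(w) = |𝒦(w,p)|²/(𝒦(p,p)𝒦(w,w)), which lies in [0,1] and has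
dV-integral 1. For l ≥ 1, H_j 𝒦(·,p)^l is square integrable of weight k+l, so reproduction there
gives the l-th β-moment of the integrand F = H_j(w) 𝒦(p,w)^k 𝒦(w,w)^{-k} (`moment_eq`). Subtracting
the multiple of the same integrand for 𝒦(·,p)^k that agrees at p leaves an integrable function G
whose positive moments all vanish. Then ∫ G = ∫ G(1-β)^N for every N, and this tends to 0 because G
= 0 where β = 0 (`integral_eq_zero_of_moments`). The missing case l = 0 follows
(`reproducing_of_norm_sq_le`).

Proper discontinuity of Γ, needed for the overlap bound and for a fundamental domain, comes from a
Carathéodory-type pseudo-distance, which automorphisms preserve. -/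

open scoped Topology ENNReal NNReal ComplexConjugate

namespace PoincareSeries

/-! ### Holomorphic maps between normed spaces -/

section NormedSpaces

open Metric Set Filter

variable {E G : Type*} [NormedAddCommGroup E] [NormedSpace ℂ E] [NormedAddCommGroup G]
  [NormedSpace ℂ G]

/-- The Cauchy estimate for the derivative of a bounded holomorphic map on a ball. -/
theorem norm_fderiv_le_of_norm_le {f : E → G} {c : E} {r M : ℝ} (hr : 0 < r)
    (hd : DifferentiableOn ℂ f (ball c r)) (hM : ∀ z ∈ ball c r, ‖f z‖ ≤ M) :
    ‖fderiv ℂ f c‖ ≤ 2 * M / r := by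
  refine Complex.norm_fderiv_le_div_of_mapsTo_ball hd (fun z hz => ?_) hr
  rw [mem_closedBall, dist_eq_norm]
  linarith [norm_sub_le (f z) (f c), hM z hz, hM c (mem_ball_self hr)]

/-- The quadratic error estimate for the linear approximation of a bounded holomorphic map. -/
theorem norm_sub_sub_fderiv_le {f : E → G} {c z : E} {r M : ℝ} (hr : 0 < r)
    (hd : DifferentiableOn ℂ f (ball c r)) (hM : ∀ z ∈ ball c r, ‖f z‖ ≤ M)
    (hz : z ∈ ball c r) :
    ‖f z - f c - fderiv ℂ f c (z - c)‖ ≤ 4 * M * (‖z - c‖ / r) ^ 2 := by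
  have hfc := (hd.differentiableAt (ball_mem_nhds c hr)).hasFDerivAt
  -- Higher-order Schwarz lemma for f minus its linear part, whose deviation from f(c) is o(z - c).
  -- The radius 4M is M + 2M + M: f, the linear part by the Cauchy estimate, and f(c).
  have key := Complex.dist_le_mul_div_pow_of_mapsTo_ball_of_isLittleO (n := 1) (c := c) (z := z)
    (f := fun z => f z - fderiv ℂ f c (z - c)) (R₁ := r) (R₂ := 4 * M)
    (hd.sub (by fun_prop)) ?_ ?_ hz
  · simp only [dist_eq_norm, sub_self, map_zero, sub_zero] at key
    rw [sub_right_comm]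
    exact key
  · intro w hw
    rw [mem_closedBall, dist_eq_norm]
    simp only [sub_self, map_zero, sub_zero]
    have h1 : ‖fderiv ℂ f c (w - c)‖ ≤ 2 * M := by
      have hw' : ‖w - c‖ ≤ r := by rw [← dist_eq_norm]; exact (mem_ball.1 hw).le
      calc _ ≤ ‖fderiv ℂ f c‖ * ‖w - c‖ := ContinuousLinearMap.le_opNorm _ _
        _ ≤ 2 * M / r * r := by
          gcongr
          · have := (norm_nonneg _).trans (hM c (mem_ball_self hr))
            positivity
          · exact norm_fderiv_le_of_norm_le hr hd hM
        _ = 2 * M := by field_simp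
    have h2 := norm_sub_le (f w - fderiv ℂ f c (w - c)) (f c)
    have h3 := norm_sub_le (f w) (fderiv ℂ f c (w - c))
    linarith [hM w hw, hM c (mem_ball_self hr)]
  · have := hfc.isLittleO
    simp only [sub_self, map_zero, sub_zero, pow_one]
    refine (this.norm_right).congr_left fun w => ?_
    abel

/-- A uniform limit of holomorphic maps on a ball is differentiable at the centre. -/
theorem differentiableAt_of_tendstoUniformlyOn_ball [CompleteSpace G] {ι : Type*} {φ : Filter ι}
    [NeBot φ] {F : ι → E → G} {f : E → G} {c : E} {r : ℝ} (hr : 0 < r)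
    (hF : TendstoUniformlyOn F f φ (ball c r))
    (hd : ∀ᶠ i in φ, DifferentiableOn ℂ (F i) (ball c r)) : DifferentiableAt ℂ f c := by
  -- a common bound on a smaller ball
  obtain ⟨ρ, hρ, hρr, M, hM⟩ : ∃ ρ > 0, ρ ≤ r ∧ ∃ M, ∀ᶠ i in φ, ∀ z ∈ ball c ρ, ‖F i z‖ ≤ M := by
    have h1 := Metric.tendstoUniformlyOn_iff.1 hF 1 one_pos
    obtain ⟨i₀, hi₀, hdi₀⟩ := (h1.and hd).exists
    have hcont : ContinuousAt (F i₀) c := (hdi₀.differentiableAt (ball_mem_nhds c hr)).continuousAt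
    obtain ⟨ρ, hρ, hb⟩ := Metric.continuousAt_iff.1 hcont 1 one_pos
    refine ⟨min ρ r, lt_min hρ hr, min_le_right _ _, ‖F i₀ c‖ + 3, ?_⟩
    filter_upwards [h1] with i hi z hz
    have hz1 := hb (lt_of_lt_of_le (mem_ball.1 hz) (min_le_left _ _))
    have hzr : z ∈ ball c r := ball_subset_ball (min_le_right _ _) hz
    have hz2 := hi z hzr
    have hz3 := hi₀ z hzr
    have : dist (F i z) 0 ≤ dist (F i z) (f z) + dist (f z) (F i₀ z) +
        (dist (F i₀ z) (F i₀ c) + dist (F i₀ c) 0) := by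
      linarith [dist_triangle (F i z) (f z) 0, dist_triangle (f z) (F i₀ z) 0,
        dist_triangle (F i₀ z) (F i₀ c) 0]
    rw [dist_zero_right, dist_zero_right, dist_comm (F i z)] at this
    linarith
  -- The Cauchy estimate for F i - F j makes the derivatives at c a Cauchy family. Their limit L is
  -- the candidate derivative of f.
  have hcauchy : Cauchy (map (fun i => fderiv ℂ (F i) c) φ) := by
    rw [Metric.cauchy_iff]
    refine ⟨inferInstance, fun ε hε => ?_⟩
    have h1 := Metric.tendstoUniformlyOn_iff.1 hF (ε * r / 8) (by positivity)
    refine ⟨_, image_mem_map (h1.and hd), ?_⟩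
    rintro _ ⟨i, ⟨hi, hdi⟩, rfl⟩ _ ⟨j, ⟨hj, hdj⟩, rfl⟩
    have hdiff := norm_fderiv_le_of_norm_le (M := ε * r / 4) hr (hdi.sub hdj) fun z hz => by
      have := dist_triangle_left (F i z) (F j z) (f z)
      rw [Pi.sub_apply, ← dist_eq_norm]
      linarith [hi z hz, hj z hz]
    rw [fderiv_sub (hdi.differentiableAt (ball_mem_nhds c hr))
      (hdj.differentiableAt (ball_mem_nhds c hr)), ← dist_eq_norm] at hdiff
    refine hdiff.trans_lt ?_
    rw [show 2 * (ε * r / 4) / r = ε / 2 by field_simp; norm_num]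
    linarith
  obtain ⟨L, hL⟩ := CompleteSpace.complete hcauchy
  have hL : Tendsto (fun i => fderiv ℂ (F i) c) φ (𝓝 L) := hL
  -- The quadratic remainder estimate has a constant independent of i, so it survives the pointwise
  -- limit.
  have hbound : ∀ z ∈ ball c ρ, ‖f z - f c - L (z - c)‖ ≤ 4 * M * (‖z - c‖ / ρ) ^ 2 := by
    intro z hz
    have hlim : Tendsto (fun i => ‖F i z - F i c - fderiv ℂ (F i) c (z - c)‖) φ
        (𝓝 ‖f z - f c - L (z - c)‖) := by
      refine (((hF.tendsto_at (ball_subset_ball hρr hz)).sub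
        (hF.tendsto_at (mem_ball_self hr))).sub ?_).norm
      exact ((ContinuousLinearMap.apply ℂ G (z - c)).continuous.tendsto L).comp hL
    refine le_of_tendsto hlim ?_
    filter_upwards [hd, hM] with i hi hMi
    exact norm_sub_sub_fderiv_le hρ (hi.mono (ball_subset_ball hρr)) hMi hz
  have : HasFDerivAt f L c := by
    rw [hasFDerivAt_iff_isLittleO]
    have hO : (fun z => f z - f c - L (z - c)) =O[𝓝 c] fun z => ‖z - c‖ ^ 2 := by
      refine Asymptotics.IsBigO.of_bound (4 * M / ρ ^ 2) ?_
      filter_upwards [ball_mem_nhds c hρ] with z hz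
      refine (hbound z hz).trans (le_of_eq ?_)
      rw [norm_pow, norm_norm]
      ring
    refine hO.trans_isLittleO ?_
    exact (Asymptotics.isLittleO_pow_sub_sub c one_lt_two)
  exact this.differentiableAt

/-- Directional derivatives of holomorphic maps are holomorphic. -/
theorem differentiableOn_fderiv_apply [CompleteSpace G] {f : E → G} {s : Set E} (hs : IsOpen s)
    (hf : DifferentiableOn ℂ f s) (v : E) : DifferentiableOn ℂ (fun z => fderiv ℂ f z v) s := by
  intro c hc
  refine DifferentiableAt.differentiableWithinAt ?_
  obtain ⟨R, hR, hRs⟩ := Metric.isOpen_iff.1 hs c hc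
  obtain ⟨ρ, hρ, hb⟩ := Metric.continuousAt_iff.1
    ((hf.differentiableAt (hs.mem_nhds hc)).continuousAt) 1 one_pos
  obtain ⟨r, hr, hrR, hrρ⟩ : ∃ r > 0, 2 * r ≤ R ∧ 2 * r ≤ ρ :=
    ⟨min R ρ / 2, by positivity, by linarith [min_le_left R ρ], by linarith [min_le_right R ρ]⟩
  set M := ‖f c‖ + 1
  have hM : ∀ z ∈ ball c (2 * r), ‖f z‖ ≤ M := by
    intro z hz
    have := hb ((mem_ball.1 hz).trans_le hrρ)
    rw [dist_eq_norm] at this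
    linarith [norm_le_norm_add_norm_sub' (f z) (f c)]
  have hd2 : DifferentiableOn ℂ f (ball c (2 * r)) :=
    hf.mono ((ball_subset_ball hrR).trans hRs)
  have hsmall : ∀ᶠ t : ℂ in 𝓝[≠] 0, ‖t • v‖ < r := by
    have : Tendsto (fun t : ℂ => ‖t • v‖) (𝓝 0) (𝓝 0) := by
      have : Continuous fun t : ℂ => ‖t • v‖ := by fun_prop
      simpa using this.tendsto 0
    exact (this.eventually (gt_mem_nhds hr)).filter_mono nhdsWithin_le_nhds
  -- The derivative along v is the limit of difference quotients. The quadratic estimate on balls of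
  -- radius r inside the ball of radius 2r makes the error O(|t|) uniformly.
  refine differentiableAt_of_tendstoUniformlyOn_ball (φ := 𝓝[≠] (0 : ℂ)) hr
    (F := fun t z => t⁻¹ • (f (z + t • v) - f z)) ?_ ?_
  · rw [Metric.tendstoUniformlyOn_iff]
    intro ε hε
    have hlim : Tendsto (fun t : ℂ => 4 * M * (‖v‖ / r) ^ 2 * ‖t‖) (𝓝[≠] 0) (𝓝 0) := by
      have : Continuous fun t : ℂ => 4 * M * (‖v‖ / r) ^ 2 * ‖t‖ := by fun_prop
      have := this.tendsto 0
      simp only [norm_zero, mul_zero] at this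
      exact this.mono_left nhdsWithin_le_nhds
    filter_upwards [hsmall, hlim.eventually (gt_mem_nhds hε), self_mem_nhdsWithin]
      with t ht htε ht0 z hz
    have hsub : ball z r ⊆ ball c (2 * r) := ball_subset_ball' (by linarith [mem_ball.1 hz])
    have hzt : z + t • v ∈ ball z r := by simpa [dist_eq_norm] using ht
    have h1 := norm_sub_sub_fderiv_le hr (hd2.mono hsub) (fun w hw => hM w (hsub hw)) hzt
    have ht0' : t ≠ 0 := ht0
    rw [add_sub_cancel_left, map_smul] at h1
    rw [dist_comm, dist_eq_norm]
    have h2 : t⁻¹ • (f (z + t • v) - f z) - fderiv ℂ f z v =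
        t⁻¹ • (f (z + t • v) - f z - t • fderiv ℂ f z v) := by
      rw [smul_sub t⁻¹ (f (z + t • v) - f z), smul_smul, inv_mul_cancel₀ ht0', one_smul]
    rw [h2, norm_smul, norm_inv]
    refine lt_of_le_of_lt ?_ htε
    have ht1 : 0 < ‖t‖ := norm_pos_iff.2 ht0'
    calc ‖t‖⁻¹ * _ ≤ ‖t‖⁻¹ * (4 * M * (‖t • v‖ / r) ^ 2) := by gcongr
      _ = _ := by rw [norm_smul]; field_simp
  · filter_upwards [hsmall] with t ht
    refine DifferentiableOn.const_smul (DifferentiableOn.sub ?_ ?_) _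
    · refine hd2.comp (by fun_prop) fun z hz => ?_
      rw [mem_ball, dist_eq_norm]
      rw [mem_ball, dist_eq_norm] at hz
      calc _ = ‖(z - c) + t • v‖ := by congr 1; abel
        _ ≤ _ := norm_add_le _ _
        _ < _ := by linarith
    · exact hd2.mono (ball_subset_ball (by linarith))

/-- The identity theorem for holomorphic maps on a connected open set. -/
theorem eqOn_zero_of_eventuallyEq_zero [CompleteSpace G] {f : E → G} {s : Set E} (hs : IsOpen s)
    (hc : IsPreconnected s) (hf : DifferentiableOn ℂ f s) {a : E} (ha : a ∈ s)
    (hfa : f =ᶠ[𝓝 a] 0) : EqOn f 0 s := by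
  have hsub : s ⊆ {z | f =ᶠ[𝓝 z] 0} := by
    refine hc.subset_of_closure_inter_subset isOpen_setOfPred_eventually_nhds ⟨a, ha, hfa⟩ ?_
    rintro b ⟨hb, hbs⟩
    obtain ⟨r, hr, hrs⟩ := Metric.isOpen_iff.1 hs b hbs
    obtain ⟨a', ha', hba'⟩ := Metric.mem_closure_iff.1 hb r hr
    have ha'b : a' ∈ ball b r := by rwa [mem_ball, dist_comm]
    refine Filter.eventually_of_mem (ball_mem_nhds b hr) fun z hz => ?_
    -- Restricting to the complex line through a' and z reduces the claim to the one-variable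
    -- identity theorem on a convex slice.
    set T : Set ℂ := (fun t : ℂ => a' + t • (z - a')) ⁻¹' ball b r
    have hTo : IsOpen T := isOpen_ball.preimage (by fun_prop)
    have hTc : IsPreconnected T := by
      have : Convex ℝ T := by
        intro x hx y hy p q hp hq hpq
        have h := convex_ball b r hx hy hp hq hpq
        have e : a' + (p • x + q • y) • (z - a') =
            p • (a' + x • (z - a')) + q • (a' + y • (z - a')) := by
          have : a' = p • a' + q • a' := by rw [← add_smul, hpq, one_smul]
          nth_rewrite 1 [this]
          simp only [add_smul, smul_add, smul_assoc]
          abel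
        simpa only [T, mem_preimage, e] using h
      exact this.isPreconnected
    have hdiff : DifferentiableOn ℂ (fun t : ℂ => f (a' + t • (z - a'))) T :=
      hf.comp (by fun_prop) fun t ht => hrs ht
    have h0 : (0 : ℂ) ∈ T := by simpa [T] using ha'b
    have h1 : (1 : ℂ) ∈ T := by simpa [T] using hz
    have := (hdiff.analyticOnNhd hTo).eqOn_zero_of_preconnected_of_eventuallyEq_zero hTc h0 ?_ h1
    · simpa using this
    · have ht : Tendsto (fun t : ℂ => a' + t • (z - a')) (𝓝 0) (𝓝 a') := by
        have : Continuous fun t : ℂ => a' + t • (z - a') := by fun_prop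
        simpa using this.tendsto 0
      exact ht.eventually ha'
  intro z hz
  exact (hsub hz).self_of_nhds

/-- A bounded separately holomorphic function of two variables is holomorphic on the diagonal. -/
theorem differentiableAt_diag {φ : ℂ → ℂ → ℂ} {c : ℂ} {r M : ℝ} (hr : 0 < r)
    (h₁ : ∀ t ∈ ball c r, DifferentiableOn ℂ (fun s => φ s t) (ball c r))
    (h₂ : ∀ s ∈ ball c r, DifferentiableOn ℂ (fun t => φ s t) (ball c r))
    (hM : ∀ s ∈ ball c r, ∀ t ∈ ball c r, ‖φ s t‖ ≤ M) :
    DifferentiableAt ℂ (fun s => φ s s) c := by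
  have hcr := mem_ball_self (x := c) hr
  have hM0 : 0 ≤ M := (norm_nonneg _).trans (hM c hcr c hcr)
  set d : ℂ → ℂ := fun t => fderiv ℂ (fun s => φ s t) c 1
  have hest : ∀ s ∈ ball c r, ∀ t ∈ ball c r,
      ‖φ s t - φ c t - (s - c) * d t‖ ≤ 4 * M * (‖s - c‖ / r) ^ 2 := by
    intro s hs t ht
    have := norm_sub_sub_fderiv_le hr (h₁ t ht) (fun s hs => hM s hs t ht) hs
    rwa [show fderiv ℂ (fun s => φ s t) c (s - c) = (s - c) * d t by
      rw [← smul_eq_mul, ← map_smul]; simp] at this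
  have hdc : DifferentiableAt ℂ d c := by
    refine differentiableAt_of_tendstoUniformlyOn_ball (φ := 𝓝[≠] (0 : ℂ)) hr
      (F := fun h t => h⁻¹ * (φ (c + h) t - φ c t)) ?_ ?_
    · rw [Metric.tendstoUniformlyOn_iff]
      intro ε hε
      have hlim : Tendsto (fun t : ℂ => 4 * M / r ^ 2 * ‖t‖) (𝓝[≠] 0) (𝓝 0) := by
        have : Continuous fun t : ℂ => 4 * M / r ^ 2 * ‖t‖ := by fun_prop
        have := this.tendsto 0
        simp only [norm_zero, mul_zero] at this
        exact this.mono_left nhdsWithin_le_nhds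
      filter_upwards [hlim.eventually (gt_mem_nhds hε), self_mem_nhdsWithin,
        nhdsWithin_le_nhds (ball_mem_nhds (0 : ℂ) hr)] with h hh h0 hhr t ht
      have h0 : h ≠ 0 := h0
      have h1 := hest (c + h) (by simpa using hhr) t ht
      rw [add_sub_cancel_left] at h1
      rw [dist_comm, dist_eq_norm]
      have h2 : h⁻¹ * (φ (c + h) t - φ c t) - d t = h⁻¹ * (φ (c + h) t - φ c t - h * d t) := by
        field_simp
      rw [h2, norm_mul, norm_inv]
      refine lt_of_le_of_lt ?_ hh
      have : 0 < ‖h‖ := norm_pos_iff.2 h0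
      calc ‖h‖⁻¹ * _ ≤ ‖h‖⁻¹ * (4 * M * (‖h‖ / r) ^ 2) := by gcongr
        _ = _ := by field_simp
    · filter_upwards [nhdsWithin_le_nhds (ball_mem_nhds (0 : ℂ) hr)] with h hh
      exact ((h₂ (c + h) (by simpa using hh)).sub (h₂ c hcr)).const_mul _
  have h₂c := ((h₂ c hcr).differentiableAt (ball_mem_nhds c hr)).hasDerivAt
  have : HasDerivAt (fun s => φ s s) (d c + deriv (fun t => φ c t) c) c := by
    rw [hasDerivAt_iff_isLittleO]
    -- The increment φ(s,s) - φ(c,c) is split into the Taylor remainder in the first slot, the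
    -- variation of d, and the increment in the second slot. The first is quadratic uniformly in t,
    -- which replaces joint continuity.
    have e1 : (fun s => φ s s - φ c s - (s - c) * d s) =o[𝓝 c] fun s => s - c := by
      have hO : (fun s => φ s s - φ c s - (s - c) * d s) =O[𝓝 c] fun s => ‖s - c‖ ^ 2 := by
        refine Asymptotics.IsBigO.of_bound (4 * M / r ^ 2) ?_
        filter_upwards [ball_mem_nhds c hr] with s hs
        refine (hest s hs s hs).trans (le_of_eq ?_)
        rw [norm_pow, norm_norm]
        ring
      exact hO.trans_isLittleO (Asymptotics.isLittleO_pow_sub_sub c one_lt_two)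
    have e2 : (fun s => (s - c) * (d s - d c)) =o[𝓝 c] fun s => s - c := by
      have : (fun s => d s - d c) =o[𝓝 c] fun _ => (1 : ℂ) := by
        rw [Asymptotics.isLittleO_one_iff]
        simpa using hdc.continuousAt.tendsto.sub_const (d c)
      simpa using (Asymptotics.isBigO_refl (fun s : ℂ => s - c) (𝓝 c)).mul_isLittleO this
    have e3 := hasDerivAt_iff_isLittleO.1 h₂c
    refine ((e1.add e2).add e3).congr_left fun s => ?_
    simp only [smul_eq_mul]
    ring
  exact this.differentiableAt

end NormedSpaces

/-! ### Polarization of sesquiholomorphic functions -/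

section Polarization

open Metric Set Filter

variable {E : Type*} [NormedAddCommGroup E] [NormedSpace ℂ E]

/-- The function s ↦ h(c + sη, c + s̄η) is holomorphic in s and vanishes for real s, where both
arguments agree. Hence it vanishes at s = i, and c, η are chosen so that c + iη = z and c - iη = a.
The radius r/4 keeps the disc |s| < 2 inside the ball. -/
theorem eq_zero_of_diag_eq_zero_of_ball {h : E → E → ℂ} {a : E} {r M : ℝ} (hr : 0 < r)
    (h₁ : ∀ w ∈ ball a r, DifferentiableOn ℂ (fun z => h z w) (ball a r))
    (h₂ : ∀ z ∈ ball a r, DifferentiableOn ℂ (fun w => conj (h z w)) (ball a r))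
    (hM : ∀ z ∈ ball a r, ∀ w ∈ ball a r, ‖h z w‖ ≤ M) (hdiag : ∀ z ∈ ball a r, h z z = 0)
    {z : E} (hz : z ∈ ball a (r / 4)) : h z a = 0 := by
  set c : E := a + (1 / 2 : ℂ) • (z - a) with hc
  set η : E := (-Complex.I / 2) • (z - a) with hη
  have hmem : ∀ s ∈ ball (0 : ℂ) 2, c + s • η ∈ ball a r := by
    intro s hs
    rw [mem_ball_zero_iff] at hs
    rw [mem_ball, dist_eq_norm] at hz ⊢
    have e : c + s • η - a = (1 / 2 + s * (-Complex.I / 2)) • (z - a) := by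
      rw [hc, hη, smul_smul, add_smul]; abel
    rw [e, norm_smul]
    have h1 : ‖1 / 2 + s * (-Complex.I / 2)‖ ≤ 2 := by
      refine (norm_add_le _ _).trans ?_
      simp only [norm_div, norm_mul, norm_neg, Complex.norm_I, norm_one, RCLike.norm_ofNat]
      linarith
    calc _ ≤ 2 * ‖z - a‖ := by gcongr
      _ < r := by linarith
  have hconj : ∀ s ∈ ball (0 : ℂ) 2, conj s ∈ ball (0 : ℂ) 2 := fun s hs => by
    simpa using hs
  set g : ℂ → ℂ := fun s => h (c + s • η) (c + (conj s) • η)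
  have hg : DifferentiableOn ℂ g (ball 0 2) := by
    intro s₀ hs₀
    refine DifferentiableAt.differentiableWithinAt ?_
    obtain ⟨ρ, hρ, hsub⟩ := Metric.isOpen_iff.1 isOpen_ball s₀ hs₀
    refine differentiableAt_diag (φ := fun s t => h (c + s • η) (c + (conj t) • η)) hρ
      (M := M) ?_ ?_ ?_
    · intro t ht
      exact (h₁ _ (hmem _ (hconj t (hsub ht)))).comp (by fun_prop) fun s hs => hmem s (hsub hs)
    · intro s hs t ht
      refine DifferentiableAt.differentiableWithinAt ?_
      have hG : DifferentiableAt ℂ (fun u : ℂ => conj (h (c + s • η) (c + u • η))) (conj t) := by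
        have := (h₂ _ (hmem s (hsub hs))).differentiableAt
          (isOpen_ball.mem_nhds (hmem _ (hconj t (hsub ht))))
        exact this.comp (conj t) (f := fun u : ℂ => c + u • η) (by fun_prop)
      have := hG.conj_conj
      simpa [Function.comp_def] using this
    · exact fun s hs t ht => hM _ (hmem s (hsub hs)) _ (hmem _ (hconj t (hsub ht)))
  have hreal : ∃ᶠ s in 𝓝[≠] (0 : ℂ), g s = 0 := by
    have ht : Tendsto (fun x : ℝ => (x : ℂ)) (𝓝[≠] 0) (𝓝[≠] 0) := by
      refine tendsto_nhdsWithin_of_tendsto_nhds_of_eventually_within _ ?_ ?_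
      · exact (Complex.continuous_ofReal.tendsto' 0 0 (by simp)).mono_left nhdsWithin_le_nhds
      · filter_upwards [self_mem_nhdsWithin] with x hx
        simpa using hx
    refine ht.frequently (Eventually.frequently ?_)
    filter_upwards [nhdsWithin_le_nhds (ball_mem_nhds (0 : ℝ) (by norm_num : (0 : ℝ) < 2))]
      with x hx
    simp only [g, Complex.conj_ofReal]
    exact hdiag _ (hmem _ (by simpa using hx))
  have := (hg.analyticOnNhd isOpen_ball).eqOn_zero_of_preconnected_of_frequently_eq_zero
    (convex_ball _ _).isPreconnected (mem_ball_self (by norm_num)) hreal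
    (show Complex.I ∈ ball (0 : ℂ) 2 by simp)
  simp only [g, hc, hη, Complex.conj_I, smul_smul, Pi.zero_apply] at this
  have e1 : Complex.I * (-Complex.I / 2) = 1 / 2 := by
    linear_combination (-1 / 2) * Complex.I_mul_I
  have e2 : -Complex.I * (-Complex.I / 2) = -(1 / 2) := by
    linear_combination (1 / 2) * Complex.I_mul_I
  rw [e1, e2, neg_smul, add_neg_cancel_right, add_assoc, ← add_smul] at this
  norm_num at this
  exact this

/-- Polarization: a sesquiholomorphic locally bounded function on a connected open set that
vanishes on the diagonal is zero. -/
theorem eq_zero_of_diag_eq_zero {h : E → E → ℂ} {D : Set E} (hD : IsOpen D)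
    (hDc : IsPreconnected D)
    (h₁ : ∀ w ∈ D, DifferentiableOn ℂ (fun z => h z w) D)
    (h₂ : ∀ z ∈ D, DifferentiableOn ℂ (fun w => conj (h z w)) D)
    (hb : ∀ a ∈ D, ∃ U ∈ 𝓝 a, ∃ M, ∀ z ∈ U, ∀ w ∈ U, ‖h z w‖ ≤ M)
    (hdiag : ∀ z ∈ D, h z z = 0) {z w : E} (hz : z ∈ D) (hw : w ∈ D) : h z w = 0 := by
  refine eqOn_zero_of_eventuallyEq_zero hD hDc (h₁ w hw) hw ?_ hz
  obtain ⟨U, hU, M, hM⟩ := hb w hw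
  obtain ⟨r, hr, hrU⟩ := Metric.mem_nhds_iff.1 (inter_mem hU (hD.mem_nhds hw))
  refine Filter.eventually_of_mem (ball_mem_nhds w (by positivity : 0 < r / 4)) fun y hy => ?_
  have hrD : ball w r ⊆ D := hrU.trans inter_subset_right
  exact eq_zero_of_diag_eq_zero_of_ball hr (fun w hw => (h₁ w (hrD hw)).mono hrD)
    (fun z hz => (h₂ z (hrD hz)).mono hrD)
    (fun z hz w hw => hM z (hrU hz).1 w (hrU hw).1) (fun z hz => hdiag z (hrD hz)) hy

end Polarization

/-! ### Sub-mean value inequality on polydiscs -/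

section MeanValue

open Metric Set Filter

variable {n : ℕ}

theorem lintegral_comp_circle_smul {e : ℂ} (he : ‖e‖ = 1) {u : (Fin n → ℂ) → ℝ≥0∞}
    (hu : Measurable u) : ∫⁻ v, u (e • v) = ∫⁻ v, u v := by
  have h : MeasurePreserving (fun v : Fin n → ℂ => e • v) volume volume := by
    have := volume_preserving_pi (f := fun _ : Fin n => fun z : ℂ => e * z) fun _ => by
      have := (rotation ⟨e, by simpa [Submonoid.unitSphere] using he⟩).measurePreserving
      exact this
    exact this
  exact h.lintegral_comp hu

/-- The sub-mean value inequality for the square of the modulus of a holomorphic function. -/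
theorem volume_mul_enorm_sq_le {f : (Fin n → ℂ) → ℂ} {c : Fin n → ℂ} {r : ℝ}
    (hf : DifferentiableOn ℂ f (ball c r)) :
    volume (ball (0 : Fin n → ℂ) r) * ‖f c‖ₑ ^ 2 ≤ ∫⁻ z in ball c r, ‖f z‖ₑ ^ 2 := by
  set u : (Fin n → ℂ) → ℝ≥0∞ := (ball 0 r).indicator fun v => ‖f (c + v)‖ₑ ^ 2 with hu
  have hmem : ∀ v ∈ ball (0 : Fin n → ℂ) r, c + v ∈ ball c r := fun v hv => by simpa using hv
  have hum : Measurable u := by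
    have hcont : ContinuousOn (fun v => ‖f (c + v)‖ₑ ^ 2) (ball (0 : Fin n → ℂ) r) := by
      have h1 : ContinuousOn (fun v => f (c + v)) (ball (0 : Fin n → ℂ) r) :=
        hf.continuousOn.comp (by fun_prop) hmem
      exact (ENNReal.continuous_pow 2).comp_continuousOn (continuous_enorm.comp_continuousOn h1)
    classical
    rw [hu, ← piecewise_eq_indicator]
    exact hcont.measurable_piecewise continuousOn_const measurableSet_ball
  have hpt : ∀ v ∈ ball (0 : Fin n → ℂ) r, ‖f c‖ₑ ^ 2 ≤
      ENNReal.ofReal (2 * Real.pi)⁻¹ *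
        ∫⁻ θ in Ioc 0 (2 * Real.pi), u (circleMap 0 1 θ • v) := by
    intro v hv
    have hv' : ∀ t : ℂ, ‖t‖ ≤ 1 → t • v ∈ ball (0 : Fin n → ℂ) r := by
      intro t ht
      rw [mem_ball_zero_iff] at hv ⊢
      rw [norm_smul]
      exact (mul_le_of_le_one_left (norm_nonneg _) ht).trans_lt hv
    -- The mean value property is applied to f² on the disc t ↦ c + tv, so that taking norms gives
    -- an average of |f|² directly. Averaging over v afterwards removes the circle, because
    -- rotations preserve volume.
    have hd : DifferentiableOn ℂ (fun t : ℂ => f (c + t • v) ^ 2) (closedBall 0 1) := by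
      refine DifferentiableOn.pow (hf.comp (by fun_prop) fun t ht => ?_) 2
      exact hmem _ (hv' t (by simpa using ht))
    have hmv := DiffContOnCl.circleAverage (R := 1) (c := (0 : ℂ))
      (f := fun t : ℂ => f (c + t • v) ^ 2) (by
        rw [abs_one]
        exact hd.diffContOnCl_ball subset_rfl)
    simp only [zero_smul, add_zero] at hmv
    rw [← enorm_pow, ← hmv, Real.circleAverage_def, enorm_smul,
      intervalIntegral.integral_of_le Real.two_pi_pos.le]
    have h2 : ‖(2 * Real.pi)⁻¹‖ₑ = ENNReal.ofReal (2 * Real.pi)⁻¹ := by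
      rw [Real.enorm_eq_ofReal (by positivity)]
    rw [h2]
    gcongr
    refine (enorm_integral_le_lintegral_enorm _).trans (le_of_eq ?_)
    refine lintegral_congr fun θ => ?_
    rw [hu, indicator_of_mem (hv' _ (by simp)), enorm_pow]
  have hmeas2 : Measurable fun p : (Fin n → ℂ) × ℝ => u (circleMap 0 1 p.2 • p.1) := by
    refine hum.comp (Continuous.measurable ?_)
    have := continuous_circleMap 0 1
    fun_prop
  calc volume (ball (0 : Fin n → ℂ) r) * ‖f c‖ₑ ^ 2
      = ∫⁻ v in ball (0 : Fin n → ℂ) r, ‖f c‖ₑ ^ 2 := by rw [setLIntegral_const, mul_comm]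
    _ ≤ ∫⁻ v in ball (0 : Fin n → ℂ) r, ENNReal.ofReal (2 * Real.pi)⁻¹ *
        ∫⁻ θ in Ioc 0 (2 * Real.pi), u (circleMap 0 1 θ • v) :=
      setLIntegral_mono' measurableSet_ball hpt
    _ ≤ ∫⁻ v : Fin n → ℂ, ENNReal.ofReal (2 * Real.pi)⁻¹ *
        ∫⁻ θ in Ioc 0 (2 * Real.pi), u (circleMap 0 1 θ • v) := setLIntegral_le_lintegral _ _
    _ = ENNReal.ofReal (2 * Real.pi)⁻¹ * ∫⁻ v : Fin n → ℂ,
        ∫⁻ θ in Ioc 0 (2 * Real.pi), u (circleMap 0 1 θ • v) :=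
      lintegral_const_mul' _ _ ENNReal.ofReal_ne_top
    _ = ENNReal.ofReal (2 * Real.pi)⁻¹ * ∫⁻ θ in Ioc 0 (2 * Real.pi),
        ∫⁻ v : Fin n → ℂ, u (circleMap 0 1 θ • v) := by
      rw [lintegral_lintegral_swap hmeas2.aemeasurable]
    _ = ENNReal.ofReal (2 * Real.pi)⁻¹ * ∫⁻ θ in Ioc 0 (2 * Real.pi), ∫⁻ v, u v := by
      congr 1
      refine lintegral_congr fun θ => ?_
      exact lintegral_comp_circle_smul (by simp) hum
    _ = ∫⁻ v, u v := by
      rw [setLIntegral_const, Real.volume_Ioc, sub_zero, mul_left_comm,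
        ← ENNReal.ofReal_mul (by positivity), inv_mul_cancel₀ (by positivity),
        ENNReal.ofReal_one, mul_one]
    _ = ∫⁻ z in ball c r, ‖f z‖ₑ ^ 2 := by
      rw [← lintegral_indicator measurableSet_ball,
        ← lintegral_add_left_eq_self ((ball c r).indicator fun z => ‖f z‖ₑ ^ 2) c]
      refine lintegral_congr fun v => ?_
      simp only [hu, indicator, mem_ball, dist_self_add_left, dist_zero_right]

end MeanValue

/-! ### Holomorphic functions on D and local L² bounds -/

section Domain

open Metric Set Filter

variable {n : ℕ} {D : Set (Fin n → ℂ)} {F : Type*} [NormedAddCommGroup F] [NormedSpace ℂ F]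

theorem isHolomorphic_const (a : F) : IsHolomorphic fun _ : D => a :=
  isHolomorphic_of_eqOn (u := fun _ => a) (differentiableOn_const a) fun _ => rfl

theorem IsHolomorphic.sub {f g : D → F} (hf : IsHolomorphic f) (hg : IsHolomorphic g) :
    IsHolomorphic fun z => f z - g z :=
  isHolomorphic_of_eqOn (DifferentiableOn.sub hf hg) fun z => by simp only [Pi.sub_apply, extend_coe]

theorem IsHolomorphic.add {f g : D → F} (hf : IsHolomorphic f) (hg : IsHolomorphic g) :
    IsHolomorphic fun z => f z + g z :=
  isHolomorphic_of_eqOn (DifferentiableOn.add hf hg) fun z => by simp only [Pi.add_apply, extend_coe]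

theorem IsHolomorphic.const_smul {f : D → F} (hf : IsHolomorphic f) (a : ℂ) :
    IsHolomorphic fun z => a • f z :=
  isHolomorphic_of_eqOn (DifferentiableOn.const_smul hf a) fun z => by
    simp only [Pi.smul_apply, extend_coe]

theorem IsHolomorphic.mul {f g : D → ℂ} (hf : IsHolomorphic f) (hg : IsHolomorphic g) :
    IsHolomorphic fun z => f z * g z :=
  isHolomorphic_of_eqOn (DifferentiableOn.mul hf hg) fun z => by simp only [Pi.mul_apply, extend_coe]

theorem IsHolomorphic.pow {f : D → ℂ} (hf : IsHolomorphic f) (k : ℕ) :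
    IsHolomorphic fun z => f z ^ k :=
  isHolomorphic_of_eqOn (DifferentiableOn.pow hf k) fun z => by simp only [Pi.pow_apply, extend_coe]

theorem isHolomorphic_pi {m : ℕ} {f : D → Fin m → ℂ} :
    IsHolomorphic f ↔ ∀ i, IsHolomorphic fun z => f z i := by
  refine ⟨fun hf i => isHolomorphic_of_eqOn (differentiableOn_pi.1 hf i) fun z => ?_,
    fun hf => isHolomorphic_of_eqOn (differentiableOn_pi.2 hf) fun z => ?_⟩
  · rw [extend_coe]
  · ext i
    rw [extend_coe]

theorem IsHolomorphic.differentiableAt (hD : IsOpen D) {f : D → F} (hf : IsHolomorphic f) (z : D) :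
    DifferentiableAt ℂ (Function.extend Subtype.val f 0) z :=
  DifferentiableOn.differentiableAt hf (hD.mem_nhds z.2)

theorem isHolomorphic_tendsto [CompleteSpace F] (hD : IsOpen D) {ι : Type*} {φ : Filter ι}
    [NeBot φ] {f : ι → D → F} {g : D → F} (hf : ∀ i, IsHolomorphic (f i))
    (h : ∀ A : Set D, IsCompact A → TendstoUniformlyOn f g φ A) : IsHolomorphic g := by
  intro c hc
  refine DifferentiableAt.differentiableWithinAt ?_
  obtain ⟨R, hR, hRD⟩ := Metric.isOpen_iff.1 hD c hc
  have hsub : closedBall c (R / 2) ⊆ D := (closedBall_subset_ball (by linarith)).trans hRD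
  refine differentiableAt_of_tendstoUniformlyOn_ball (r := R / 2) (by positivity) (φ := φ)
    (F := fun i => Function.extend Subtype.val (f i) 0) ?_ ?_
  · have hA : IsCompact ((↑) ⁻¹' closedBall c (R / 2) : Set D) := by
      rw [Subtype.isCompact_iff, Subtype.image_preimage_coe, inter_eq_right.2 hsub]
      exact isCompact_closedBall _ _
    have := h _ hA
    rw [Metric.tendstoUniformlyOn_iff] at this ⊢
    intro ε hε
    filter_upwards [this ε hε] with i hi z hz
    have hzD := hsub (ball_subset_closedBall hz)
    have := hi ⟨z, hzD⟩ (ball_subset_closedBall hz)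
    rwa [← extend_coe g ⟨z, hzD⟩, ← extend_coe (f i) ⟨z, hzD⟩] at this
  · exact Eventually.of_forall fun i =>
      DifferentiableOn.mono (hf i) (ball_subset_closedBall.trans hsub)

theorem setLIntegral_le_setLIntegral_eucVolume (hD : IsOpen D) {f : D → ℂ}
    {S T : Set (Fin n → ℂ)} (hST : S ⊆ T) (hTD : T ⊆ D) (hT : MeasurableSet T) :
    ∫⁻ w in S, ‖Function.extend Subtype.val f 0 w‖ₑ ^ 2 ≤
      ∫⁻ w in ((↑) ⁻¹' T : Set D), ‖f w‖ₑ ^ 2 ∂(eucVolume D) := by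
  have hT' : MeasurableSet ((↑) ⁻¹' T : Set D) := measurable_subtype_coe hT
  calc _ ≤ ∫⁻ w in T, ‖Function.extend Subtype.val f 0 w‖ₑ ^ 2 := lintegral_mono_set hST
    _ = ∫⁻ w in D, T.indicator (fun w => ‖Function.extend Subtype.val f 0 w‖ₑ ^ 2) w := by
      rw [setLIntegral_indicator hT, inter_eq_left.2 hTD]
    _ = ∫⁻ w : D, T.indicator (fun w => ‖Function.extend Subtype.val f 0 w‖ₑ ^ 2) w
        ∂(eucVolume D) := (lintegral_subtype_comap hD.measurableSet _).symm
    _ = _ := by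
      rw [← lintegral_indicator hT']
      refine lintegral_congr fun w => ?_
      by_cases hw : (w : Fin n → ℂ) ∈ T
      · rw [indicator_of_mem hw, indicator_of_mem (by exact hw), extend_coe]
      · rw [indicator_of_notMem hw, indicator_of_notMem (by exact hw)]

/-- On a compact set, values of holomorphic functions are bounded by local `L²` norms. -/
theorem exists_enorm_sq_le_setLIntegral (hD : IsOpen D) {A : Set D} (hA : IsCompact A) :
    ∃ A' : Set D, IsCompact A' ∧ ∃ C : ℝ≥0, ∀ f : D → ℂ, IsHolomorphic f → ∀ z ∈ A,
      ‖f z‖ₑ ^ 2 ≤ C * ∫⁻ w in A', ‖f w‖ₑ ^ 2 ∂(eucVolume D) := by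
  have hA1 : IsCompact ((↑) '' A : Set (Fin n → ℂ)) := Subtype.isCompact_iff.1 hA
  have hAD : ((↑) '' A : Set (Fin n → ℂ)) ⊆ D := by
    rintro _ ⟨z, _, rfl⟩
    exact z.2
  obtain ⟨δ, hδ, hsub⟩ := hA1.exists_cthickening_subset_open hD hAD
  have hT : IsCompact (cthickening δ ((↑) '' A : Set (Fin n → ℂ))) := hA1.cthickening
  have hA' : IsCompact ((↑) ⁻¹' cthickening δ ((↑) '' A : Set (Fin n → ℂ)) : Set D) := by
    rw [Subtype.isCompact_iff, Subtype.image_preimage_coe, inter_eq_right.2 hsub]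
    exact hT
  obtain ⟨v, hv, hv0⟩ : ∃ v : ℝ≥0, volume (ball (0 : Fin n → ℂ) δ) = v ∧ v ≠ 0 := by
    have hvol' : volume (ball (0 : Fin n → ℂ) δ) ≠ ∞ := measure_ball_lt_top.ne
    have hvol : volume (ball (0 : Fin n → ℂ) δ) ≠ 0 := (measure_ball_pos _ _ hδ).ne'
    exact ⟨_, (ENNReal.coe_toNNReal hvol').symm, by
      rw [Ne, ENNReal.toNNReal_eq_zero_iff]
      tauto⟩
  refine ⟨_, hA', v⁻¹, fun f hf z hz => ?_⟩
  have hball : ball (z : Fin n → ℂ) δ ⊆ cthickening δ ((↑) '' A : Set (Fin n → ℂ)) :=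
    ball_subset_closedBall.trans (closedBall_subset_cthickening (mem_image_of_mem _ hz) δ)
  have h1 := volume_mul_enorm_sq_le (DifferentiableOn.mono hf (hball.trans hsub))
  rw [extend_coe, hv] at h1
  have h2 := h1.trans (setLIntegral_le_setLIntegral_eucVolume hD hball hsub hT.measurableSet)
  calc ‖f z‖ₑ ^ 2 = (v⁻¹ : ℝ≥0) * (v * ‖f z‖ₑ ^ 2) := by
        rw [← mul_assoc, ← ENNReal.coe_mul, inv_mul_cancel₀ hv0, ENNReal.coe_one, one_mul]
    _ ≤ _ := by gcongr

end Domain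

/-! ### Reproducing kernels of weighted Bergman spaces -/

section Kernels

open Metric Set Filter

variable {n : ℕ} {D : Set (Fin n → ℂ)}

/-- Point evaluations of holomorphic functions are bounded in the `L²(μ)` norm, locally uniformly
in the point. -/
def EvalBounded (μ : Measure D) : Prop :=
  ∀ A : Set D, IsCompact A → ∃ C : ℝ≥0, ∀ f : D → ℂ, IsHolomorphic f → ∀ z ∈ A,
    ‖f z‖ₑ ^ 2 ≤ C * ∫⁻ w, ‖f w‖ₑ ^ 2 ∂μ

/-- `K` is a Hermitian reproducing kernel of the space of `μ`-square integrable holomorphic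
functions. -/
structure IsReproducingKernel (μ : Measure D) (K : D → D → ℂ) : Prop where
  holo : ∀ w : D, IsHolomorphic fun z => K z w
  memLp : ∀ w : D, MemLp (fun z => K z w) 2 μ
  hermitian : ∀ z w : D, K z w = conj (K w z)
  reproducing : ∀ f : D → ℂ, IsHolomorphic f → MemLp f 2 μ → ∀ z : D,
    f z = ∫ w : D, f w * K z w ∂μ

theorem lintegral_enorm_sq_eq {μ : Measure D} (f : D → ℂ) :
    ∫⁻ w, ‖f w‖ₑ ^ 2 ∂μ = eLpNorm f 2 μ ^ 2 := by
  have := eLpNorm_nnreal_pow_eq_lintegral (f := f) (μ := μ) (p := 2) (by norm_num)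
  simpa using this.symm

/-- Each kernel reproduces the columns of the other; Hermitian symmetry identifies the two resulting
integrals. -/
theorem IsReproducingKernel.unique {μ : Measure D} {K L : D → D → ℂ}
    (hK : IsReproducingKernel μ K) (hL : IsReproducingKernel μ L) : K = L := by
  funext z w
  have h1 := hL.reproducing _ (hK.holo w) (hK.memLp w) z
  have h2 := hK.reproducing _ (hL.holo z) (hL.memLp z) w
  rw [h1, hL.hermitian z w, h2, ← integral_conj]
  congr 1
  funext u
  rw [map_mul, hL.hermitian z u, hK.hermitian u w]
  simp [mul_comm]

theorem EvalBounded.eq_of_ae_eq {μ : Measure D} (hμ : EvalBounded μ) {f g : D → ℂ}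
    (hf : IsHolomorphic f) (hg : IsHolomorphic g) (h : f =ᵐ[μ] g) : f = g := by
  funext z
  obtain ⟨C, hC⟩ := hμ {z} isCompact_singleton
  have h1 := hC _ (hf.sub hg) z rfl
  have h2 : ∫⁻ w, ‖f w - g w‖ₑ ^ 2 ∂μ = 0 := by
    rw [lintegral_congr_ae (g := fun _ => 0), lintegral_zero]
    filter_upwards [h] with w hw
    simp [hw]
  rw [h2, mul_zero, nonpos_iff_eq_zero, pow_eq_zero_iff two_ne_zero, enorm_eq_zero,
    sub_eq_zero] at h1
  exact h1

/-- The Bergman space of `μ`, as a subspace of `L²(μ)`. -/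
def bergmanSubmodule (μ : Measure D) : Submodule ℂ (Lp ℂ 2 μ) where
  carrier := {F | ∃ f : D → ℂ, IsHolomorphic f ∧ F =ᵐ[μ] f}
  add_mem' := by
    rintro F G ⟨f, hf, hF⟩ ⟨g, hg, hG⟩
    refine ⟨fun z => f z + g z, hf.add hg, ?_⟩
    filter_upwards [Lp.coeFn_add F G, hF, hG] with z h1 h2 h3
    rw [h1, Pi.add_apply, h2, h3]
  zero_mem' := ⟨fun _ => 0, isHolomorphic_const 0, Lp.coeFn_zero ℂ 2 μ⟩
  smul_mem' := by
    rintro a F ⟨f, hf, hF⟩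
    refine ⟨fun z => a • f z, hf.const_smul a, ?_⟩
    filter_upwards [Lp.coeFn_smul a F, hF] with z h1 h2
    rw [h1, Pi.smul_apply, h2]

theorem enorm_sub_sq_le {μ : Measure D} {C : ℝ≥0} {A : Set D}
    (hC : ∀ f : D → ℂ, IsHolomorphic f → ∀ z ∈ A, ‖f z‖ₑ ^ 2 ≤ C * ∫⁻ w, ‖f w‖ₑ ^ 2 ∂μ)
    {F G : Lp ℂ 2 μ} {f g : D → ℂ} (hf : IsHolomorphic f) (hg : IsHolomorphic g)
    (hF : F =ᵐ[μ] f) (hG : G =ᵐ[μ] g) {z : D} (hz : z ∈ A) :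
    ‖f z - g z‖ ≤ √C * ‖F - G‖ := by
  have h1 := hC _ (hf.sub hg) z hz
  rw [lintegral_enorm_sq_eq, eLpNorm_congr_ae (g := (F - G : Lp ℂ 2 μ)), ← Lp.enorm_def] at h1
  · have h2 : ‖f z - g z‖ ^ 2 ≤ C * ‖F - G‖ ^ 2 := by
      have := ENNReal.toReal_mono (by finiteness) h1
      simpa using this
    rw [← Real.sqrt_sq (norm_nonneg (f z - g z)), ← Real.sqrt_sq (norm_nonneg (F - G)),
      ← Real.sqrt_mul (by positivity)]
    exact Real.sqrt_le_sqrt h2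
  · filter_upwards [Lp.coeFn_sub F G, hF, hG] with w h1 h2 h3
    rw [h1, Pi.sub_apply, h2, h3]

/-- Bounded evaluation turns L² convergence into locally uniform convergence of the holomorphic
representatives, whose limit is again holomorphic. -/
theorem isClosed_bergmanSubmodule (hD : IsOpen D) {μ : Measure D} (hμ : EvalBounded μ) :
    IsClosed (bergmanSubmodule μ : Set (Lp ℂ 2 μ)) := by
  refine IsSeqClosed.isClosed fun x F hx hxF => ?_
  choose f hf hxf using hx
  have huc : ∀ A : Set D, IsCompact A → UniformCauchySeqOn f atTop A := by
    intro A hA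
    obtain ⟨C, hC⟩ := hμ A hA
    rw [Metric.uniformCauchySeqOn_iff]
    intro ε hε
    obtain ⟨N, hN⟩ := Metric.cauchySeq_iff.1 hxF.cauchySeq (ε / (√C + 1)) (by positivity)
    refine ⟨N, fun i hi j hj z hz => ?_⟩
    have h1 := enorm_sub_sq_le hC (hf i) (hf j) (hxf i) (hxf j) hz
    have h2 := hN i hi j hj
    rw [dist_eq_norm] at h2 ⊢
    rw [lt_div_iff₀ (by positivity)] at h2
    nlinarith [norm_nonneg (x i - x j)]
  have hlim : ∀ z, ∃ a, Tendsto (fun i => f i z) atTop (𝓝 a) := fun z =>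
    cauchySeq_tendsto_of_complete ((huc {z} isCompact_singleton).cauchySeq rfl)
  choose g hg using hlim
  refine ⟨g, isHolomorphic_tendsto hD (φ := atTop) hf fun A hA =>
    (huc A hA).tendstoUniformlyOn_of_tendsto fun z _ => hg z, ?_⟩
  -- An almost everywhere convergent subsequence identifies the L² limit with the locally uniform
  -- limit g.
  obtain ⟨ns, hns, hae⟩ := (tendstoInMeasure_of_tendsto_Lp hxF).exists_seq_tendsto_ae
  filter_upwards [hae, ae_all_iff.2 hxf] with z h1 h2
  refine tendsto_nhds_unique h1 ?_
  simp only [h2]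
  exact (hg z).comp hns.tendsto_atTop

/-- Existence of the weighted Bergman kernel. -/
theorem exists_isReproducingKernel (hD : IsOpen D) {μ : Measure D} (hμ : EvalBounded μ) :
    ∃ K : D → D → ℂ, IsReproducingKernel μ K := by
  have : CompleteSpace (bergmanSubmodule μ) :=
    (isClosed_bergmanSubmodule hD hμ).completeSpace_coe
  choose rep hrep hrepae using fun F : bergmanSubmodule μ => F.2
  have hrep_eq : ∀ (F : bergmanSubmodule μ) (f : D → ℂ), IsHolomorphic f → F =ᵐ[μ] f →
      rep F = f := fun F f hf hFf =>
    hμ.eq_of_ae_eq (hrep F) hf ((hrepae F).symm.trans hFf)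
  have hev : ∀ z : D, ∃ ev : StrongDual ℂ (bergmanSubmodule μ), ∀ F, ev F = rep F z := by
    intro z
    obtain ⟨C, hC⟩ := hμ {z} isCompact_singleton
    let e : bergmanSubmodule μ →ₗ[ℂ] ℂ :=
      { toFun := fun F => rep F z
        map_add' := fun F G => by
          have := hrep_eq (F + G) (fun z => rep F z + rep G z) ((hrep F).add (hrep G)) (by
            filter_upwards [Lp.coeFn_add (F : Lp ℂ 2 μ) G, hrepae F, hrepae G] with z h1 h2 h3
            rw [Submodule.coe_add, h1, Pi.add_apply, h2, h3])
          exact congrFun this z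
        map_smul' := fun a F => by
          have := hrep_eq (a • F) (fun z => a • rep F z) ((hrep F).const_smul a) (by
            filter_upwards [Lp.coeFn_smul a (F : Lp ℂ 2 μ), hrepae F] with z h1 h2
            rw [Submodule.coe_smul, h1, Pi.smul_apply, h2])
          exact congrFun this z }
    refine ⟨e.mkContinuous (√C) fun F => ?_, fun F => rfl⟩
    have := enorm_sub_sq_le hC (hrep F) (isHolomorphic_const 0) (hrepae F)
      (Lp.coeFn_zero ℂ 2 μ) (rfl : z ∈ ({z} : Set D))
    simpa [e] using this
  choose ev hev using hev
  -- Riesz representatives of the evaluations. Their representing functions are the columns of the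
  -- kernel.
  set k : D → bergmanSubmodule μ := fun z => (InnerProductSpace.toDual ℂ _).symm (ev z) with hk
  have hinner : ∀ z F, inner ℂ (k z) F = rep F z := fun z F => by
    rw [hk, InnerProductSpace.toDual_symm_apply, hev]
  have hsymm : ∀ z w, rep (k w) z = conj (rep (k z) w) := fun z w => by
    rw [← hinner, ← hinner]
    exact (inner_conj_symm (k z) (k w)).symm
  refine ⟨fun z w => rep (k w) z, fun w => hrep _, fun w => ?_, hsymm,
    fun f hf hfL z => ?_⟩
  · exact (memLp_congr_ae (hrepae (k w))).1 (Lp.memLp _)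
  · have hfm : hfL.toLp f ∈ bergmanSubmodule μ := ⟨f, hf, hfL.coeFn_toLp⟩
    have h1 := hinner z ⟨_, hfm⟩
    rw [hrep_eq ⟨_, hfm⟩ f hf hfL.coeFn_toLp, Submodule.coe_inner, L2.inner_def] at h1
    rw [← h1]
    refine integral_congr_ae ?_
    filter_upwards [hfL.coeFn_toLp, hrepae (k z)] with w h2 h3
    simp only [h2, h3, RCLike.inner_apply]
    rw [hsymm z w]

variable {μ : Measure D} {K : D → D → ℂ}

theorem IsReproducingKernel.inner_toLp (hK : IsReproducingKernel μ K) (z w : D) :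
    inner ℂ ((hK.memLp z).toLp _) ((hK.memLp w).toLp _) = K z w := by
  rw [L2.inner_def, hK.reproducing _ (hK.holo w) (hK.memLp w) z]
  refine integral_congr_ae ?_
  filter_upwards [(hK.memLp z).coeFn_toLp, (hK.memLp w).coeFn_toLp] with u h1 h2
  rw [h1, h2, RCLike.inner_apply, ← hK.hermitian z u]

theorem IsReproducingKernel.norm_sq_toLp (hK : IsReproducingKernel μ K) (z : D) :
    ((‖(hK.memLp z).toLp _‖ ^ 2 : ℝ) : ℂ) = K z z := by
  rw [← hK.inner_toLp, inner_self_eq_norm_sq_to_K]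
  simp

theorem IsReproducingKernel.re_diag_nonneg (hK : IsReproducingKernel μ K) (z : D) :
    0 ≤ (K z z).re := by
  rw [← hK.norm_sq_toLp, Complex.ofReal_re]
  positivity

theorem IsReproducingKernel.ofReal_re_diag (hK : IsReproducingKernel μ K) (z : D) :
    ((K z z).re : ℂ) = K z z := by
  rw [← hK.norm_sq_toLp, Complex.ofReal_re]

theorem IsReproducingKernel.lintegral_enorm_sq (hK : IsReproducingKernel μ K) (z : D) :
    ∫⁻ w, ‖K w z‖ₑ ^ 2 ∂μ = ENNReal.ofReal (K z z).re := by
  rw [lintegral_enorm_sq_eq, ← hK.norm_sq_toLp, Complex.ofReal_re,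
    ENNReal.ofReal_pow (norm_nonneg _), ofReal_norm, Lp.enorm_toLp]

theorem IsReproducingKernel.norm_sq_le (hK : IsReproducingKernel μ K) (z w : D) :
    ‖K z w‖ ^ 2 ≤ (K z z).re * (K w w).re := by
  rw [← hK.norm_sq_toLp z, ← hK.norm_sq_toLp w, Complex.ofReal_re, Complex.ofReal_re,
    ← hK.inner_toLp, ← mul_pow]
  gcongr
  exact norm_inner_le_norm _ _

theorem IsReproducingKernel.norm_comm (hK : IsReproducingKernel μ K) (z w : D) :
    ‖K z w‖ = ‖K w z‖ := by
  rw [hK.hermitian, RCLike.norm_conj]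

/-- The evaluation bound for the column K(·,z) at z itself reads K(z,z)² ≤ C K(z,z). -/
theorem IsReproducingKernel.exists_re_diag_le (hK : IsReproducingKernel μ K) (hμ : EvalBounded μ)
    {A : Set D} (hA : IsCompact A) : ∃ C : ℝ≥0, ∀ z ∈ A, (K z z).re ≤ C := by
  obtain ⟨C, hC⟩ := hμ A hA
  refine ⟨C, fun z hz => ?_⟩
  have h1 := hC _ (hK.holo z) z hz
  rw [hK.lintegral_enorm_sq] at h1
  replace h1 := ENNReal.toReal_mono (by finiteness) h1
  rw [ENNReal.toReal_pow, toReal_enorm, ENNReal.toReal_mul,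
    ENNReal.toReal_ofReal (hK.re_diag_nonneg z), ENNReal.coe_toReal] at h1
  replace h1 := (pow_le_pow_left₀ (hK.re_diag_nonneg z) (Complex.re_le_norm _) 2).trans h1
  rcases (hK.re_diag_nonneg z).eq_or_lt with h0 | h0
  · rw [← h0]; exact C.2
  · rw [sq] at h1
    exact le_of_mul_le_mul_right h1 h0

theorem IsReproducingKernel.exists_norm_le (hK : IsReproducingKernel μ K) (hμ : EvalBounded μ)
    {A : Set D} (hA : IsCompact A) : ∃ C : ℝ, ∀ z ∈ A, ∀ w ∈ A, ‖K z w‖ ≤ C := by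
  obtain ⟨C, hC⟩ := hK.exists_re_diag_le hμ hA
  refine ⟨C, fun z hz w hw => ?_⟩
  refine le_of_sq_le_sq ?_ C.2
  calc _ ≤ _ := hK.norm_sq_le z w
    _ ≤ C * C := mul_le_mul (hC z hz) (hC w hw) (hK.re_diag_nonneg _) C.2
    _ = _ := by ring

theorem exists_isCompact_closedBall (hD : IsOpen D) (a : D) : ∃ r > 0,
    closedBall (a : Fin n → ℂ) r ⊆ D ∧
      IsCompact ((↑) ⁻¹' closedBall (a : Fin n → ℂ) r : Set D) := by
  obtain ⟨R, hR, hRD⟩ := Metric.isOpen_iff.1 hD a a.2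
  have hsub : closedBall (a : Fin n → ℂ) (R / 2) ⊆ D :=
    (closedBall_subset_ball (by linarith)).trans hRD
  refine ⟨R / 2, by positivity, hsub, ?_⟩
  rw [Subtype.isCompact_iff, Subtype.image_preimage_coe, inter_eq_right.2 hsub]
  exact isCompact_closedBall _ _

theorem IsReproducingKernel.continuous_diag (hD : IsOpen D) (hK : IsReproducingKernel μ K)
    (hμ : EvalBounded μ) : Continuous fun z => K z z := by
  rw [continuous_iff_continuousAt]
  intro a
  obtain ⟨r, hr, hrD, hrc⟩ := exists_isCompact_closedBall hD a
  obtain ⟨M, hM⟩ := hK.exists_norm_le hμ hrc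
  have haA : a ∈ ((↑) ⁻¹' closedBall (a : Fin n → ℂ) r : Set D) := by simp [hr.le]
  -- Schwarz lemma for K(·,z), with a bound M independent of z near a. Only continuity in the second
  -- variable at the fixed point a then remains.
  have h1 : Tendsto (fun z => K z z - K a z) (𝓝 a) (𝓝 0) := by
    refine squeeze_zero_norm' (a := fun z : D => 2 * M / r * dist (z : Fin n → ℂ) a) ?_ ?_
    · have hnh : ((↑) ⁻¹' ball (a : Fin n → ℂ) r : Set D) ∈ 𝓝 a :=
        continuous_subtype_val.continuousAt (ball_mem_nhds _ hr)
      filter_upwards [hnh] with z hz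
      have hz' : z ∈ ((↑) ⁻¹' closedBall (a : Fin n → ℂ) r : Set D) := ball_subset_closedBall hz
      have := Complex.dist_le_div_mul_dist_of_mapsTo_ball (R₂ := 2 * M)
        (f := Function.extend Subtype.val (fun y => K y z) 0) (c := (a : Fin n → ℂ)) (z := z)
        (DifferentiableOn.mono (hK.holo z) (ball_subset_closedBall.trans hrD)) ?_ hz
      · rwa [extend_coe, extend_coe, dist_eq_norm] at this
      · intro y hy
        have hyD := hrD (ball_subset_closedBall hy)
        have e := extend_coe (fun y => K y z) ⟨y, hyD⟩
        rw [mem_closedBall, extend_coe, e, dist_eq_norm]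
        have h3 := hM ⟨y, hyD⟩ (ball_subset_closedBall hy) z hz'
        linarith [norm_sub_le (K ⟨y, hyD⟩ z) (K a z), hM a haA z hz']
    · have : Continuous fun z : D => 2 * M / r * dist (z : Fin n → ℂ) a := by fun_prop
      simpa using this.tendsto a
  have h2 : Tendsto (fun z => K a z) (𝓝 a) (𝓝 (K a a)) := by
    have : Continuous fun z => K a z := by
      simp_rw [hK.hermitian a]
      exact Complex.continuous_conj.comp (hK.holo a).continuous
    exact this.tendsto a
  simpa [ContinuousAt] using h1.add h2

/-- A Hermitian reproducing kernel with the same diagonal as a power of another one, up to a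
constant, is equal to that multiple of the power. -/
theorem IsReproducingKernel.eq_const_mul_pow (hD : IsOpen D) (hDc : IsPreconnected D)
    (hμ : EvalBounded μ) (hK : IsReproducingKernel μ K) {ν : Measure D} (hν : EvalBounded ν)
    {L : D → D → ℂ} (hL : IsReproducingKernel ν L) {c : ℝ} {k : ℕ}
    (hdiag : ∀ z, L z z = c * K z z ^ k) (z w : D) : L z w = c * K z w ^ k := by
  set H : D → D → ℂ := fun z w => L z w - c * K z w ^ k with hH
  have hHc : ∀ z w, H z w = conj (H w z) := fun z w => by
    simp only [hH, map_sub, map_mul, map_pow, Complex.conj_ofReal, ← hL.hermitian, ← hK.hermitian]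
  have hHh : ∀ w, IsHolomorphic fun z => H z w := fun w =>
    (hL.holo w).sub (((isHolomorphic_const (c : ℂ)).mul ((hK.holo w).pow k)))
  set h : (Fin n → ℂ) → (Fin n → ℂ) → ℂ := fun z w =>
    Function.extend Subtype.val (fun z' => Function.extend Subtype.val (fun w' => H z' w') 0 w) 0 z
    with hh
  have hval : ∀ z w : D, h z w = H z w := fun z w => by
    rw [hh]
    simp only
    rw [extend_coe, extend_coe]
  have := eq_zero_of_diag_eq_zero (h := h) hD hDc ?_ ?_ ?_ ?_ z.2 w.2
  · rw [hval] at this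
    exact sub_eq_zero.1 this
  · intro w hw
    refine DifferentiableOn.congr (hHh ⟨w, hw⟩) fun z hz => ?_
    exact (hval ⟨z, hz⟩ ⟨w, hw⟩).trans (extend_coe (fun z => H z ⟨w, hw⟩) ⟨z, hz⟩).symm
  · intro z hz
    refine DifferentiableOn.congr (hHh ⟨z, hz⟩) fun w hw => ?_
    have e := extend_coe (fun w => H w ⟨z, hz⟩) ⟨w, hw⟩
    have e' := hval ⟨z, hz⟩ ⟨w, hw⟩
    simp only at e e'
    rw [e, e', hHc ⟨w, hw⟩]
  · intro a ha
    obtain ⟨r, hr, hrD, hrc⟩ := exists_isCompact_closedBall hD ⟨a, ha⟩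
    obtain ⟨M, hM⟩ := hK.exists_norm_le hμ hrc
    obtain ⟨N, hN⟩ := hL.exists_norm_le hν hrc
    refine ⟨_, closedBall_mem_nhds a hr, N + |c| * M ^ k, fun z hz w hw => ?_⟩
    have e := hval ⟨z, hrD hz⟩ ⟨w, hrD hw⟩
    simp only at e
    rw [e]
    refine (norm_sub_le _ _).trans (add_le_add (hN _ hz _ hw) ?_)
    rw [norm_mul, norm_pow, Complex.norm_real, Real.norm_eq_abs]
    gcongr
    exact hM _ hz _ hw
  · intro z hz
    have e := hval ⟨z, hz⟩ ⟨z, hz⟩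
    simp only at e
    rw [e]
    exact sub_eq_zero.2 (hdiag _)

end Kernels

/-! ### Automorphisms, Jacobians and change of variables -/

section Automorphisms

open Metric Set Filter

variable {n : ℕ} {D : Set (Fin n → ℂ)}

theorem isHolomorphic_smul (g : Aut D) : IsHolomorphic fun z : D => ((g • z : D) : Fin n → ℂ) :=
  g.2.1

theorem continuous_aut_smul (g : Aut D) : Continuous fun z : D => g • z :=
  Continuous.subtype_mk (isHolomorphic_smul g).continuous _

theorem IsHolomorphic.comp_smul {F : Type*} [NormedAddCommGroup F] [NormedSpace ℂ F] {f : D → F}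
    (hf : IsHolomorphic f) (g : Aut D) : IsHolomorphic fun z => f (g • z) :=
  hf.comp_val (isHolomorphic_smul g)

/-- The extension by zero of an automorphism. -/
noncomputable def autExt (g : Aut D) : (Fin n → ℂ) → (Fin n → ℂ) :=
  Function.extend Subtype.val (fun w : D => ((g • w : D) : Fin n → ℂ)) 0

theorem autExt_coe (g : Aut D) (z : D) : autExt g z = (g • z : D) := extend_coe _ z

theorem jacobian_eq (g : Aut D) (z : D) : jacobian g z = (fderiv ℂ (autExt g) z).det := rfl

theorem differentiableAt_autExt (hD : IsOpen D) (g : Aut D) (z : D) :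
    DifferentiableAt ℂ (autExt g) z :=
  (isHolomorphic_smul g).differentiableAt hD z

theorem jacobian_mul (hD : IsOpen D) (g h : Aut D) (z : D) :
    jacobian (g * h) z = jacobian g (h • z) * jacobian h z := by
  have he : autExt (g * h) =ᶠ[𝓝 (z : Fin n → ℂ)] autExt g ∘ autExt h := by
    filter_upwards [hD.mem_nhds z.2] with y hy
    have h1 := autExt_coe (g * h) ⟨y, hy⟩
    have h2 := autExt_coe h ⟨y, hy⟩
    simp only at h1 h2
    rw [Function.comp_apply, h1, h2, autExt_coe, mul_smul]
  have hg : DifferentiableAt ℂ (autExt g) (autExt h z) := by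
    rw [autExt_coe]; exact differentiableAt_autExt hD g _
  rw [jacobian_eq, he.fderiv_eq, fderiv_comp _ hg (differentiableAt_autExt hD h z), autExt_coe,
    jacobian_eq, jacobian_eq, ContinuousLinearMap.det, ContinuousLinearMap.det,
    ContinuousLinearMap.det, ContinuousLinearMap.toLinearMap_comp, LinearMap.det_comp]

theorem jacobian_one (hD : IsOpen D) (z : D) : jacobian (1 : Aut D) z = 1 := by
  have he : autExt (1 : Aut D) =ᶠ[𝓝 (z : Fin n → ℂ)] id := by
    filter_upwards [hD.mem_nhds z.2] with y hy
    have h1 := autExt_coe 1 ⟨y, hy⟩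
    simp only [one_smul] at h1
    rw [h1, id]
  rw [jacobian_eq, he.fderiv_eq, fderiv_id, ContinuousLinearMap.det]
  exact LinearMap.det_id

theorem jacobian_inv_mul (hD : IsOpen D) (g : Aut D) (z : D) :
    jacobian g⁻¹ (g • z) * jacobian g z = 1 := by
  rw [← jacobian_mul hD, inv_mul_cancel, jacobian_one hD]

theorem jacobian_ne_zero (hD : IsOpen D) (g : Aut D) (z : D) : jacobian g z ≠ 0 :=
  right_ne_zero_of_mul_eq_one (jacobian_inv_mul hD g z)

theorem isHolomorphic_jacobian (hD : IsOpen D) (g : Aut D) : IsHolomorphic (jacobian g) := by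
  refine isHolomorphic_of_eqOn (u := fun z => (fderiv ℂ (autExt g) z).det) ?_ fun z => rfl
  have hent : ∀ i j : Fin n,
      DifferentiableOn ℂ (fun z => fderiv ℂ (autExt g) z (Pi.single j 1) i) D := fun i j =>
    differentiableOn_pi.1 (differentiableOn_fderiv_apply hD (isHolomorphic_smul g) _) i
  -- The Leibniz expansion exhibits the Jacobian as a polynomial in the holomorphic partial
  -- derivatives.
  have hdet : (fun z => (fderiv ℂ (autExt g) z).det) = fun z =>
      ∑ σ : Equiv.Perm (Fin n), ((Equiv.Perm.sign σ : ℤ) : ℂ) *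
        ∏ i, fderiv ℂ (autExt g) z (Pi.single i 1) (σ i) := by
    funext z
    rw [ContinuousLinearMap.det, ← LinearMap.det_toMatrix', Matrix.det_apply']
    simp [LinearMap.toMatrix'_apply]
  rw [hdet]
  refine DifferentiableOn.fun_sum fun σ _ => DifferentiableOn.const_mul ?_ _
  exact fun z hz => (HasFDerivWithinAt.finsetProd fun i _ =>
    (hent (σ i) i z hz).hasFDerivWithinAt).differentiableWithinAt

theorem continuous_jacobian (hD : IsOpen D) (g : Aut D) : Continuous (jacobian g) :=
  (isHolomorphic_jacobian hD g).continuous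

/-- A measure on `D` transforms under automorphisms with the factor `|J|^{2k}`. -/
def QuasiInvariant (k : ℕ) (μ : Measure D) : Prop :=
  ∀ (g : Aut D) (u : D → ℝ≥0∞), Measurable u →
    ∫⁻ z, (‖jacobian g z‖ₑ ^ 2) ^ k * u (g • z) ∂μ = ∫⁻ z, u z ∂μ

theorem abs_det_restrictScalars (L : (Fin n → ℂ) →L[ℂ] (Fin n → ℂ)) :
    |(L.restrictScalars ℝ).det| = ‖L.det‖ ^ 2 := by
  have : (L.restrictScalars ℝ).det = ‖L.det‖ ^ 2 := by
    simp [ContinuousLinearMap.det, LinearMap.det_restrictScalars, Algebra.norm_complex_eq,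
      Complex.normSq_eq_norm_sq]
  rw [this, abs_of_nonneg (by positivity)]

/-- The change of variables formula for automorphisms. -/
theorem quasiInvariant_eucVolume (hD : IsOpen D) : QuasiInvariant 1 (eucVolume D) := by
  intro g u hu
  set ue : (Fin n → ℂ) → ℝ≥0∞ := Function.extend Subtype.val u 0 with hue
  have hue_coe : ∀ z : D, ue z = u z := fun z => Subtype.val_injective.extend_apply u 0 z
  have himg : autExt g '' D = D := by
    ext y
    constructor
    · rintro ⟨z, hz, rfl⟩
      have := autExt_coe g ⟨z, hz⟩
      simp only at this
      rw [this]
      exact Subtype.coe_prop _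
    · intro hy
      refine ⟨(g⁻¹ • (⟨y, hy⟩ : D) : D), Subtype.coe_prop _, ?_⟩
      rw [autExt_coe, smul_inv_smul]
  have hinj : InjOn (autExt g) D := by
    intro y hy z hz h
    have h1 := autExt_coe g ⟨y, hy⟩
    have h2 := autExt_coe g ⟨z, hz⟩
    simp only at h1 h2
    rw [h1, h2] at h
    exact congrArg Subtype.val (MulAction.injective g (Subtype.ext h))
  have key := lintegral_image_eq_lintegral_abs_det_fderiv_mul volume hD.measurableSet
    (f := autExt g) (f' := fun z => (fderiv ℂ (autExt g) z).restrictScalars ℝ)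
    (fun z hz => ((differentiableAt_autExt hD g ⟨z, hz⟩).hasFDerivAt.restrictScalars
      ℝ).hasFDerivWithinAt) hinj ue
  rw [himg, ← lintegral_subtype_comap hD.measurableSet,
    ← lintegral_subtype_comap hD.measurableSet] at key
  simp only [hue_coe, autExt_coe, abs_det_restrictScalars] at key
  rw [eucVolume, key]
  refine lintegral_congr fun z => ?_
  rw [pow_one, jacobian_eq, ENNReal.ofReal_pow (norm_nonneg _), ofReal_norm]

/-- This passes from Euclidean volume, of weight 1, to the weights 𝒦(z,z)^{1-k}, of weight k. The
hypothesis on ω is the cocycle identity that the Jacobian factors require. -/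
theorem QuasiInvariant.withDensity (hD : IsOpen D) {μ : Measure D} {k l : ℕ}
    (hμ : QuasiInvariant k μ) {ω : D → ℝ≥0∞} (hω : Measurable ω)
    (hωJ : ∀ (g : Aut D) z, (‖jacobian g z‖ₑ ^ 2) ^ l * ω z =
      (‖jacobian g z‖ₑ ^ 2) ^ k * ω (g • z)) :
    QuasiInvariant l (μ.withDensity ω) := by
  intro g u hu
  have hg := (continuous_aut_smul g).measurable
  have hJ := (continuous_jacobian hD g).measurable
  rw [lintegral_withDensity_eq_lintegral_mul _ hω (by fun_prop),
    lintegral_withDensity_eq_lintegral_mul _ hω hu, ← hμ g _ (hω.mul hu)]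
  refine lintegral_congr fun z => ?_
  simp only [Pi.mul_apply]
  rw [← mul_assoc, ← mul_assoc, mul_comm (ω z), hωJ]

theorem QuasiInvariant.measurePreserving (hD : IsOpen D) {μ : Measure D} {k : ℕ}
    (hμ : QuasiInvariant k μ) (g : Aut D) :
    MeasurePreserving (fun z : D => g • z)
      (μ.withDensity fun z => (‖jacobian g z‖ₑ ^ 2) ^ k) μ := by
  have hg := (continuous_aut_smul g).measurable
  have hJ := (continuous_jacobian hD g).measurable
  refine ⟨hg, Measure.ext fun s hs => ?_⟩
  rw [← lintegral_indicator_one hs, ← lintegral_indicator_one hs,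
    lintegral_map (by measurability) hg, ← hμ g _ (by measurability),
    lintegral_withDensity_eq_lintegral_mul _ (by fun_prop)]
  · rfl
  · exact (measurable_one.indicator hs).comp hg

theorem measurableEmbedding_aut_smul (g : Aut D) : MeasurableEmbedding fun z : D => g • z :=
  (MeasurableEquiv.mk (MulAction.toPerm g) (continuous_aut_smul g).measurable
    (continuous_aut_smul g⁻¹).measurable).measurableEmbedding

theorem QuasiInvariant.integral_comp (hD : IsOpen D) {μ : Measure D} {k : ℕ}
    (hμ : QuasiInvariant k μ) (g : Aut D) (F : D → ℂ) :
    ∫ z, ((‖jacobian g z‖ ^ 2) ^ k : ℝ) * F (g • z) ∂μ = ∫ z, F z ∂μ := by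
  have hJ := (continuous_jacobian hD g).measurable
  rw [← (hμ.measurePreserving hD g).integral_comp (measurableEmbedding_aut_smul g) F,
    integral_withDensity_eq_integral_toReal_smul (by fun_prop)
      (Eventually.of_forall fun z => by finiteness)]
  refine integral_congr_ae (Eventually.of_forall fun z => ?_)
  simp

/-- The weight `k` action of an automorphism on functions. -/
noncomputable def slash (k : ℕ) (g : Aut D) (f : D → ℂ) (z : D) : ℂ :=
  f (g • z) * jacobian g z ^ k

theorem IsHolomorphic.slash (hD : IsOpen D) {f : D → ℂ} (hf : IsHolomorphic f) (k : ℕ)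
    (g : Aut D) : IsHolomorphic (slash k g f) :=
  (hf.comp_smul g).mul ((isHolomorphic_jacobian hD g).pow k)

theorem QuasiInvariant.lintegral_slash {μ : Measure D} {k : ℕ}
    (hμ : QuasiInvariant k μ) (g : Aut D) {f : D → ℂ} (hf : IsHolomorphic f) (S : Set D)
    (hS : MeasurableSet S) :
    ∫⁻ z in S, ‖slash k g f z‖ₑ ^ 2 ∂μ = ∫⁻ z in (g⁻¹ • · ) ⁻¹' S, ‖f z‖ₑ ^ 2 ∂μ := by
  have hS' : MeasurableSet ((g⁻¹ • · ) ⁻¹' S : Set D) :=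
    (continuous_aut_smul g⁻¹).measurable hS
  have hfm := hf.continuous.measurable
  rw [← lintegral_indicator hS, ← lintegral_indicator hS',
    ← hμ g _ (Measurable.indicator (by fun_prop) hS')]
  refine lintegral_congr fun z => ?_
  by_cases hz : z ∈ S
  · rw [indicator_of_mem hz, indicator_of_mem (by simpa using hz), PoincareSeries.slash, enorm_mul,
      enorm_pow]
    ring
  · rw [indicator_of_notMem hz, indicator_of_notMem (by simpa using hz), mul_zero]

theorem memLp_two_iff {μ : Measure D} {f : D → ℂ} (hf : IsHolomorphic f) :
    MemLp f 2 μ ↔ ∫⁻ z, ‖f z‖ₑ ^ 2 ∂μ < ∞ := by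
  rw [lintegral_enorm_sq_eq]
  refine ⟨fun h => ENNReal.pow_lt_top h.2, fun h => ⟨hf.continuous.aestronglyMeasurable, ?_⟩⟩
  simpa using h

theorem QuasiInvariant.memLp_slash (hD : IsOpen D) {μ : Measure D} {k : ℕ}
    (hμ : QuasiInvariant k μ) (g : Aut D) {f : D → ℂ} (hf : IsHolomorphic f)
    (hfL : MemLp f 2 μ) : MemLp (slash k g f) 2 μ := by
  rw [memLp_two_iff (hf.slash hD k g)]
  have := hμ.lintegral_slash g hf univ MeasurableSet.univ
  rw [preimage_univ, Measure.restrict_univ] at this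
  rw [this]
  exact (memLp_two_iff hf).1 hfL

/-- The transformation law of reproducing kernels of quasi-invariant measures. -/
theorem IsReproducingKernel.transform (hD : IsOpen D) {μ : Measure D} {k : ℕ}
    (hμ : QuasiInvariant k μ) {K : D → D → ℂ} (hK : IsReproducingKernel μ K) (g : Aut D)
    (z w : D) :
    K (g • z) (g • w) * jacobian g z ^ k * conj (jacobian g w) ^ k = K z w := by
  -- The transformed kernel is again reproducing for μ, so uniqueness gives the law. Reproduction
  -- follows by applying K to the translate of f by g⁻¹ and changing variables by g.
  have key : IsReproducingKernel μ fun z w =>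
      K (g • z) (g • w) * jacobian g z ^ k * conj (jacobian g w) ^ k := by
    refine ⟨fun w => ?_, fun w => ?_, fun z w => ?_, fun f hf hfL z => ?_⟩
    · exact ((hK.holo (g • w)).slash hD k g).mul (isHolomorphic_const _)
    · have h1 := hμ.memLp_slash hD g (hK.holo (g • w)) (hK.memLp (g • w))
      exact h1.mul_const _
    · simp only [map_mul, map_pow, Complex.conj_conj, ← hK.hermitian]
      ring
    · have hf' := hf.slash hD k g⁻¹
      have hfL' := hμ.memLp_slash hD g⁻¹ hf hfL
      have h1 := hK.reproducing _ hf' hfL' (g • z)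
      have hJ := jacobian_inv_mul hD g z
      have h2 : f z = jacobian g z ^ k * slash k g⁻¹ f (g • z) := by
        rw [PoincareSeries.slash, inv_smul_smul, mul_left_comm, ← mul_pow, mul_comm (jacobian g z),
          hJ, one_pow, mul_one]
      rw [h2, h1, ← hμ.integral_comp hD g, ← integral_const_mul]
      refine integral_congr_ae (Eventually.of_forall fun w => ?_)
      have hJw := jacobian_inv_mul hD g w
      simp only [PoincareSeries.slash, inv_smul_smul]
      have h3 : (((‖jacobian g w‖ ^ 2) ^ k : ℝ) : ℂ) =
          jacobian g w ^ k * conj (jacobian g w) ^ k := by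
        rw [← mul_pow, Complex.mul_conj, Complex.normSq_eq_norm_sq]
        push_cast
        rfl
      rw [h3]
      have h4 : jacobian g⁻¹ (g • w) ^ k * jacobian g w ^ k = 1 := by
        rw [← mul_pow, hJw, one_pow]
      linear_combination (jacobian g z ^ k * conj (jacobian g w) ^ k * f w *
        K (g • z) (g • w)) * h4
  exact congrFun (congrFun (key.unique hK) z) w

end Automorphisms

/-! ### Bergman kernel, weighted measures and the Berezin function -/

section Bergman

open Metric Set Filter

variable {n : ℕ} {D : Set (Fin n → ℂ)}

theorem evalBounded_eucVolume (hD : IsOpen D) : EvalBounded (eucVolume D) := by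
  intro A hA
  obtain ⟨A', -, C, hC⟩ := exists_enorm_sq_le_setLIntegral hD hA
  refine ⟨C, fun f hf z hz => (hC f hf z hz).trans ?_⟩
  gcongr
  exact Measure.restrict_le_self

/-- The local L² bound only involves a compact set A', on which a continuous positive weight has a
positive minimum δ. -/
theorem evalBounded_withDensity (hD : IsOpen D) {ω : D → ℝ} (hω : Continuous ω)
    (hpos : ∀ z, 0 < ω z) :
    EvalBounded ((eucVolume D).withDensity fun z => ENNReal.ofReal (ω z)) := by
  intro A hA
  obtain ⟨A', hA', C, hC⟩ := exists_enorm_sq_le_setLIntegral hD hA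
  obtain ⟨δ, hδ, hδω⟩ : ∃ δ : ℝ≥0, δ ≠ 0 ∧ ∀ z ∈ A', (δ : ℝ) ≤ ω z := by
    rcases A'.eq_empty_or_nonempty with rfl | hne
    · exact ⟨1, one_ne_zero, by simp⟩
    · obtain ⟨a, -, ha⟩ := hA'.exists_isMinOn hne hω.continuousOn
      exact ⟨⟨ω a, (hpos a).le⟩, fun h => (hpos a).ne' (congrArg NNReal.toReal h),
        fun z hz => ha hz⟩
  refine ⟨C * δ⁻¹, fun f hf z hz => (hC f hf z hz).trans ?_⟩
  have hfm := hf.continuous.measurable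
  have hωm := hω.measurable
  rw [ENNReal.coe_mul, mul_assoc,
    lintegral_withDensity_eq_lintegral_mul _ (by fun_prop) (by fun_prop)]
  gcongr
  calc ∫⁻ w in A', ‖f w‖ₑ ^ 2 ∂(eucVolume D)
      ≤ ∫⁻ w in A', (δ⁻¹ : ℝ≥0) * (ENNReal.ofReal (ω w) * ‖f w‖ₑ ^ 2) ∂(eucVolume D) := by
        refine setLIntegral_mono' hA'.measurableSet fun w hw => ?_
        rw [← mul_assoc]
        refine le_mul_of_one_le_left' ?_
        calc (1 : ℝ≥0∞) = (δ⁻¹ : ℝ≥0) * δ := by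
              rw [← ENNReal.coe_mul, inv_mul_cancel₀ hδ, ENNReal.coe_one]
          _ ≤ _ := by
              gcongr
              rw [← ENNReal.ofReal_coe_nnreal]
              exact ENNReal.ofReal_le_ofReal (hδω w hw)
    _ ≤ ∫⁻ w, (δ⁻¹ : ℝ≥0) * (ENNReal.ofReal (ω w) * ‖f w‖ₑ ^ 2) ∂(eucVolume D) :=
        setLIntegral_le_lintegral _ _
    _ = _ := by
        rw [lintegral_const_mul' _ _ ENNReal.coe_ne_top]
        rfl

theorem isReproducingKernel_bergmanKernel (hD : IsOpen D) :
    IsReproducingKernel (eucVolume D) (bergmanKernel D) := by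
  have hex : ∃ K, IsBergmanKernel D K := by
    obtain ⟨K, hK⟩ := exists_isReproducingKernel hD (evalBounded_eucVolume hD)
    exact ⟨K, fun w => ⟨hK.holo w, hK.memLp w⟩, hK.hermitian,
      fun f hf z => hK.reproducing f hf.1 hf.2 z⟩
  have hK : IsBergmanKernel D (bergmanKernel D) := by
    rw [bergmanKernel, dif_pos hex]
    exact hex.choose_spec
  exact ⟨fun w => (hK.mem w).1, fun w => (hK.mem w).2, hK.hermitian,
    fun f hf hfL z => hK.reproducing f ⟨hf, hfL⟩ z⟩

/-- The Bergman kernel on the diagonal, as a real number. -/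
noncomputable def bergmanDiag (z : D) : ℝ := (bergmanKernel D z z).re

theorem ofReal_bergmanDiag (hD : IsOpen D) (z : D) :
    (bergmanDiag z : ℂ) = bergmanKernel D z z :=
  (isReproducingKernel_bergmanKernel hD).ofReal_re_diag z

theorem continuous_bergmanDiag (hD : IsOpen D) : Continuous (bergmanDiag (D := D)) :=
  Complex.continuous_re.comp
    ((isReproducingKernel_bergmanKernel hD).continuous_diag hD (evalBounded_eucVolume hD))

/-- Since D is bounded, the constant 1 is a Bergman function. If 𝒦(z,z) = 0, the column at z
vanishes almost everywhere, and reproducing 1 at z would give 1 = 0. -/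
theorem bergmanDiag_pos (hD : IsOpen D) (hb : Bornology.IsBounded D) (z : D) :
    0 < bergmanDiag z := by
  have hK := isReproducingKernel_bergmanKernel hD
  refine (hK.re_diag_nonneg z).lt_of_ne fun h0 => ?_
  have : IsFiniteMeasure (eucVolume D) := by
    refine ⟨?_⟩
    rw [eucVolume, Measure.comap_apply _ Subtype.val_injective
      (fun s hs => hD.measurableSet.subtype_image hs) _ MeasurableSet.univ]
    exact (measure_mono (by simp)).trans_lt hb.measure_lt_top
  have h1 := hK.lintegral_enorm_sq z
  have hm := (hK.holo z).continuous.measurable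
  rw [← h0, ENNReal.ofReal_zero, lintegral_eq_zero_iff (by fun_prop)] at h1
  have h2 := hK.reproducing _ (isHolomorphic_const 1) (memLp_const 1) z
  rw [integral_eq_zero_of_ae] at h2
  · exact one_ne_zero h2
  · filter_upwards [h1] with w hw
    have : bergmanKernel D w z = 0 := by simpa using hw
    rw [one_mul, hK.hermitian z w, this, map_zero, Pi.zero_apply]

theorem bergmanKernel_smul_smul (hD : IsOpen D) (g : Aut D) (z w : D) :
    bergmanKernel D (g • z) (g • w) * jacobian g z * conj (jacobian g w) =
      bergmanKernel D z w := by
  simpa using (isReproducingKernel_bergmanKernel hD).transform hD (quasiInvariant_eucVolume hD)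
    g z w

theorem bergmanDiag_smul (hD : IsOpen D) (g : Aut D) (z : D) :
    bergmanDiag (g • z) * ‖jacobian g z‖ ^ 2 = bergmanDiag z := by
  have h := bergmanKernel_smul_smul hD g z z
  rw [mul_assoc, Complex.mul_conj, Complex.normSq_eq_norm_sq, ← ofReal_bergmanDiag hD,
    ← ofReal_bergmanDiag hD] at h
  exact_mod_cast h

variable (D) in
/-- The measure `𝒦(z,z)^{-k} dV(z)`. -/
noncomputable def weightVolume (k : ℕ) : Measure D :=
  (eucVolume D).withDensity fun z => ENNReal.ofReal (bergmanDiag z * (bergmanDiag z ^ k)⁻¹)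

theorem weightVolume_zero : weightVolume D 0 = invVolume D := by
  simp only [weightVolume, pow_zero, inv_one, mul_one, invVolume, bergmanDiag]

variable (hD : IsOpen D) (hb : Bornology.IsBounded D)

include hD in
theorem measurable_bergmanDiag : Measurable (bergmanDiag (D := D)) :=
  (continuous_bergmanDiag hD).measurable

include hD hb in
theorem evalBounded_weightVolume (k : ℕ) : EvalBounded (weightVolume D k) := by
  have hpos := bergmanDiag_pos hD hb
  refine evalBounded_withDensity hD (ω := fun z => bergmanDiag z * (bergmanDiag z ^ k)⁻¹) ?_
    fun z => mul_pos (hpos z) (inv_pos.2 (pow_pos (hpos z) k))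
  exact (continuous_bergmanDiag hD).mul
    (((continuous_bergmanDiag hD).pow k).inv₀ fun z => (pow_pos (hpos z) k).ne')

include hD hb in
theorem quasiInvariant_weightVolume (k : ℕ) : QuasiInvariant k (weightVolume D k) := by
  have hpos := bergmanDiag_pos hD hb
  have hm := measurable_bergmanDiag hD
  refine (quasiInvariant_eucVolume hD).withDensity hD (by fun_prop) fun g z => ?_
  rw [← ofReal_norm, ← ENNReal.ofReal_pow (norm_nonneg _), ← ENNReal.ofReal_pow (by positivity),
    ← ENNReal.ofReal_pow (by positivity), ← ENNReal.ofReal_mul (by positivity),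
    ← ENNReal.ofReal_mul (by positivity), ← bergmanDiag_smul hD g z]
  congr 1
  have h1 := (hpos (g • z)).ne'
  have h2 := norm_ne_zero_iff.2 (jacobian_ne_zero hD g z)
  field_simp
  rw [mul_pow]

include hD hb in
theorem quasiInvariant_invVolume : QuasiInvariant 0 (invVolume D) := by
  rw [← weightVolume_zero]
  exact quasiInvariant_weightVolume hD hb 0

include hD hb in
theorem weightVolume_eq (k : ℕ) : weightVolume D k =
    (invVolume D).withDensity fun z => ENNReal.ofReal (bergmanDiag z ^ k)⁻¹ := by
  have hpos := bergmanDiag_pos hD hb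
  have hm := measurable_bergmanDiag hD
  have : invVolume D = (eucVolume D).withDensity fun z => ENNReal.ofReal (bergmanDiag z) := rfl
  rw [this, ← withDensity_mul _ (by fun_prop) (by fun_prop), weightVolume]
  congr 1
  funext z
  rw [Pi.mul_apply, ENNReal.ofReal_mul (hpos z).le]

include hD hb in
theorem integral_weightVolume (k : ℕ) (f : D → ℂ) :
    ∫ z, f z ∂(weightVolume D k) =
      ∫ z, f z * ((bergmanDiag z ^ k)⁻¹ : ℝ) ∂(invVolume D) := by
  have hpos := bergmanDiag_pos hD hb
  have hm := measurable_bergmanDiag hD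
  rw [weightVolume_eq hD hb, integral_withDensity_eq_integral_toReal_smul (by fun_prop)
    (Eventually.of_forall fun z => ENNReal.ofReal_lt_top)]
  refine integral_congr_ae (Eventually.of_forall fun z => ?_)
  simp only
  rw [ENNReal.toReal_ofReal (inv_nonneg.2 (pow_nonneg (hpos z).le k)), Complex.real_smul, mul_comm]

/-- The Berezin function `|𝒦(w,p)|² / (𝒦(p,p) 𝒦(w,w))`. -/
noncomputable def berezin (p w : D) : ℝ :=
  ‖bergmanKernel D w p‖ ^ 2 / (bergmanDiag p * bergmanDiag w)

include hD hb in
theorem berezin_nonneg (p w : D) : 0 ≤ berezin p w :=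
  div_nonneg (sq_nonneg _)
    (mul_nonneg (bergmanDiag_pos hD hb p).le (bergmanDiag_pos hD hb w).le)

include hD hb in
theorem berezin_le_one (p w : D) : berezin p w ≤ 1 := by
  have h := (isReproducingKernel_bergmanKernel hD).norm_sq_le w p
  refine div_le_one_of_le₀ (h.trans (le_of_eq (mul_comm _ _))) ?_
  exact mul_nonneg (bergmanDiag_pos hD hb p).le (bergmanDiag_pos hD hb w).le

include hD in
theorem measurable_berezin (p : D) : Measurable (berezin p) := by
  have h1 := ((isReproducingKernel_bergmanKernel hD).holo p).continuous.measurable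
  have h2 := measurable_bergmanDiag hD
  unfold berezin
  fun_prop

include hD hb in
-- The density 𝒦(w,w) of dV cancels one denominator, and the column 𝒦(·,p) has squared L² norm
-- 𝒦(p,p).
theorem lintegral_berezin (p : D) : ∫⁻ w, ENNReal.ofReal (berezin p w) ∂(invVolume D) = 1 := by
  have hK := isReproducingKernel_bergmanKernel hD
  have hpos := bergmanDiag_pos hD hb
  have hm := measurable_bergmanDiag hD
  have hm' := measurable_berezin hD p
  have h1 := hK.lintegral_enorm_sq p
  have : invVolume D = (eucVolume D).withDensity fun z => ENNReal.ofReal (bergmanDiag z) := rfl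
  rw [this, lintegral_withDensity_eq_lintegral_mul _ (by fun_prop) (by fun_prop)]
  have h2 : ∀ w, (((fun z => ENNReal.ofReal (bergmanDiag z)) * fun w =>
      ENNReal.ofReal (berezin p w) : D → ℝ≥0∞)) w =
      ENNReal.ofReal (bergmanDiag p)⁻¹ * ‖bergmanKernel D w p‖ₑ ^ 2 := by
    intro w
    have hw := (hpos w).ne'
    have hp := hpos p
    rw [Pi.mul_apply, ← ENNReal.ofReal_mul (hpos w).le, ← ofReal_norm,
      ← ENNReal.ofReal_pow (norm_nonneg _), ← ENNReal.ofReal_mul (by positivity)]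
    congr 1
    rw [berezin]
    field_simp
  simp_rw [h2]
  rw [lintegral_const_mul' _ _ ENNReal.ofReal_ne_top, h1,
    ← ENNReal.ofReal_mul (inv_nonneg.2 (hpos p).le)]
  change ENNReal.ofReal ((bergmanDiag p)⁻¹ * bergmanDiag p) = 1
  rw [inv_mul_cancel₀ (hpos p).ne', ENNReal.ofReal_one]

include hD hb in
theorem integrable_berezin (p : D) : Integrable (berezin p) (invVolume D) := by
  refine ⟨(measurable_berezin hD p).aestronglyMeasurable, ?_⟩
  rw [hasFiniteIntegral_iff_ofReal (Eventually.of_forall (berezin_nonneg hD hb p)),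
    lintegral_berezin hD hb]
  exact ENNReal.one_lt_top

include hD hb in
theorem norm_sq_bergmanKernel (p w : D) :
    ‖bergmanKernel D w p‖ ^ 2 = berezin p w * (bergmanDiag p * bergmanDiag w) := by
  have h1 := (bergmanDiag_pos hD hb p).ne'
  have h2 := (bergmanDiag_pos hD hb w).ne'
  rw [berezin]
  field_simp

include hD hb in
/-- If `|f|² ≤ M 𝒦(w,w)^k` then `f 𝒦(·,p)^l` is square integrable of weight `k + l`, `l ≥ 1`. -/
theorem memLp_mul_bergmanKernel_pow {f : D → ℂ} (hf : IsHolomorphic f) {k : ℕ} {M : ℝ}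
    (hM : ∀ w, ‖f w‖ ^ 2 ≤ M * bergmanDiag w ^ k) (p : D) {l : ℕ} (hl : 1 ≤ l) :
    MemLp (fun w => f w * bergmanKernel D w p ^ l) 2 (weightVolume D (k + l)) := by
  have hpos := bergmanDiag_pos hD hb
  have hm := measurable_bergmanDiag hD
  have hK := isReproducingKernel_bergmanKernel hD
  have hM0 : 0 ≤ M := by
    have h1 := (sq_nonneg _).trans (hM p)
    exact nonneg_of_mul_nonneg_left h1 (pow_pos (hpos p) k)
  have hh := hf.mul ((hK.holo p).pow l)
  have hhm := hh.continuous.measurable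
  rw [memLp_two_iff hh, weightVolume_eq hD hb,
    lintegral_withDensity_eq_lintegral_mul _ (by fun_prop) (by fun_prop)]
  -- After the powers of 𝒦(w,w) cancel, the integrand is at most M 𝒦(p,p)^l β^l. One factor β
  -- suffices for integrability, which is why l ≥ 1 is needed.
  refine lt_of_le_of_lt (b := ∫⁻ w, ENNReal.ofReal (M * bergmanDiag p ^ l) *
    ENNReal.ofReal (berezin p w) ∂(invVolume D)) (lintegral_mono fun w => ?_) ?_
  · have hw := hpos w
    have hp := hpos p
    have hβ0 := berezin_nonneg hD hb p w
    have hβ1 := berezin_le_one hD hb p w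
    rw [Pi.mul_apply, ← ofReal_norm, ← ENNReal.ofReal_pow (norm_nonneg _),
      ← ENNReal.ofReal_mul (by positivity), ← ENNReal.ofReal_mul (by positivity)]
    refine ENNReal.ofReal_le_ofReal ?_
    rw [norm_mul, norm_pow, mul_pow, ← pow_mul, mul_comm l 2, pow_mul,
      norm_sq_bergmanKernel hD hb]
    calc (bergmanDiag w ^ (k + l))⁻¹ * (‖f w‖ ^ 2 *
          (berezin p w * (bergmanDiag p * bergmanDiag w)) ^ l)
        ≤ (bergmanDiag w ^ (k + l))⁻¹ * (M * bergmanDiag w ^ k *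
          (berezin p w * (bergmanDiag p * bergmanDiag w)) ^ l) := by
          gcongr
          exact hM w
      _ = M * bergmanDiag p ^ l * berezin p w ^ l := by
          rw [mul_pow, mul_pow, pow_add]
          field_simp
      _ ≤ M * bergmanDiag p ^ l * berezin p w := by
          gcongr
          exact pow_le_of_le_one hβ0 hβ1 (by omega)
  · rw [lintegral_const_mul' _ _ ENNReal.ofReal_ne_top, lintegral_berezin hD hb, mul_one]
    exact ENNReal.ofReal_lt_top

end Bergman

/-! ### The constant c(D,k) and the reproducing formula under a growth bound -/

section Reproducing

open Metric Set Filter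

variable {n : ℕ} {D : Set (Fin n → ℂ)} (hD : IsBoundedSymmetricDomain D)

include hD in
/-- The kernel of weight `k` is a positive multiple of the `k`-th power of the Bergman kernel. -/
theorem exists_isReproducingKernel_pow {k : ℕ} (hk : 1 ≤ k) : ∃ c : ℝ, 0 < c ∧
    IsReproducingKernel (weightVolume D k) fun z w => c * bergmanKernel D z w ^ k := by
  have hpos := bergmanDiag_pos hD.isOpen hD.isBounded
  have hE := evalBounded_weightVolume hD.isOpen hD.isBounded k
  have hK := isReproducingKernel_bergmanKernel hD.isOpen
  obtain ⟨L, hL⟩ := exists_isReproducingKernel hD.isOpen hE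
  obtain ⟨p, hp⟩ := hD.isConnected.nonempty
  lift p to D using hp
  have hLp : 0 < (L p p).re := by
    refine (hL.re_diag_nonneg p).lt_of_ne fun h0 => ?_
    have h1 := hL.lintegral_enorm_sq p
    have hm := (hL.holo p).continuous.measurable
    rw [← h0, ENNReal.ofReal_zero, lintegral_eq_zero_iff (by fun_prop)] at h1
    have hmem := memLp_mul_bergmanKernel_pow hD.isOpen hD.isBounded
      (isHolomorphic_const (1 : ℂ)) (k := 0) (M := 1) (by simp) p hk
    simp only [zero_add, one_mul] at hmem
    have h2 := hL.reproducing _ ((hK.holo p).pow k) hmem p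
    rw [integral_eq_zero_of_ae, ← ofReal_bergmanDiag hD.isOpen] at h2
    · exact pow_ne_zero k (Complex.ofReal_ne_zero.2 (hpos p).ne') h2
    · filter_upwards [h1] with w hw
      have : L w p = 0 := by simpa using hw
      rw [hL.hermitian p w, this, map_zero, mul_zero, Pi.zero_apply]
  refine ⟨(L p p).re / bergmanDiag p ^ k, div_pos hLp (pow_pos (hpos p) k), ?_⟩
  -- L(z,z) and 𝒦(z,z)^k scale by the same power of |J|, so their ratio is invariant and, by
  -- transitivity, constant.
  have hdiag : ∀ z, L z z = ((L p p).re / bergmanDiag p ^ k : ℝ) * bergmanKernel D z z ^ k := by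
    intro z
    obtain ⟨g, rfl⟩ := hD.transitive p z
    have h1 := hL.transform hD.isOpen (quasiInvariant_weightVolume hD.isOpen hD.isBounded k) g p p
    rw [mul_assoc, ← mul_pow, Complex.mul_conj, Complex.normSq_eq_norm_sq,
      ← hL.ofReal_re_diag p, ← hL.ofReal_re_diag (g • p)] at h1
    have h2 : (L (g • p) (g • p)).re * (‖jacobian g p‖ ^ 2) ^ k = (L p p).re := by
      exact_mod_cast h1
    rw [← hL.ofReal_re_diag, ← ofReal_bergmanDiag hD.isOpen, ← h2, ← bergmanDiag_smul hD.isOpen g p,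
      ← Complex.ofReal_pow, ← Complex.ofReal_mul]
    congr 1
    have h3 := norm_ne_zero_iff.2 (jacobian_ne_zero hD.isOpen g p)
    have h4 := (hpos (g • p)).ne'
    rw [mul_pow]
    field_simp
  have : L = fun z w => ((L p p).re / bergmanDiag p ^ k : ℝ) * bergmanKernel D z w ^ k := by
    funext z w
    exact hK.eq_const_mul_pow hD.isOpen hD.isConnected.isPreconnected
      (evalBounded_eucVolume hD.isOpen) hE hL hdiag z w
  rw [← this]
  exact hL

include hD in
-- The equation defining c(D,k) is the reproducing formula of c𝒦^k applied to its own column at z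
-- and divided by c. It has only one solution because 𝒦(p,p) ≠ 0.
theorem isReproducingKernel_bergmanConst {k : ℕ} (hk : 1 ≤ k) : 0 < bergmanConst D k ∧
    IsReproducingKernel (weightVolume D k) fun z w =>
      bergmanConst D k * bergmanKernel D z w ^ k := by
  have hpos := bergmanDiag_pos hD.isOpen hD.isBounded
  obtain ⟨c, hc, hL⟩ := exists_isReproducingKernel_pow hD hk
  have hspec : ∀ z : D, (c : ℂ) * ∫ w : D, bergmanKernel D z w ^ k * bergmanKernel D w z ^ k /
      bergmanKernel D w w ^ k ∂(invVolume D) = bergmanKernel D z z ^ k := by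
    intro z
    have h1 := hL.reproducing _ (hL.holo z) (hL.memLp z) z
    rw [integral_weightVolume hD.isOpen hD.isBounded] at h1
    have hc' : (c : ℂ) ≠ 0 := Complex.ofReal_ne_zero.2 hc.ne'
    refine mul_left_cancel₀ hc' ?_
    rw [h1, ← integral_const_mul, ← integral_const_mul]
    refine integral_congr_ae (Eventually.of_forall fun w => ?_)
    simp only
    rw [← ofReal_bergmanDiag hD.isOpen w]
    push_cast
    ring
  have hex : ∃ c : ℝ, ∀ z : D, (c : ℂ) * ∫ w : D, bergmanKernel D z w ^ k *
      bergmanKernel D w z ^ k / bergmanKernel D w w ^ k ∂(invVolume D) =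
        bergmanKernel D z z ^ k := ⟨c, hspec⟩
  have hc' : bergmanConst D k = c := by
    obtain ⟨p, hp⟩ := hD.isConnected.nonempty
    lift p to D using hp
    have h1 : (bergmanConst D k : ℂ) * ∫ w : D, bergmanKernel D p w ^ k *
        bergmanKernel D w p ^ k / bergmanKernel D w w ^ k ∂(invVolume D) =
          bergmanKernel D p p ^ k := by
      rw [bergmanConst, dif_pos hex]
      exact hex.choose_spec p
    rw [← hspec p] at h1
    have h2 : bergmanKernel D p p ^ k ≠ 0 := by
      rw [← ofReal_bergmanDiag hD.isOpen]
      exact pow_ne_zero k (Complex.ofReal_ne_zero.2 (hpos p).ne')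
    rw [← hspec p] at h2
    exact_mod_cast mul_right_cancel₀ (right_ne_zero_of_mul h2) h1
  rw [hc']
  exact ⟨hc, hL⟩

/-- A function whose moments of positive order with respect to `β` vanish, and which vanishes where
`β` does, has integral zero. -/
theorem integral_eq_zero_of_moments {X : Type*} [MeasurableSpace X] {μ : Measure X} {G : X → ℂ}
    {β : X → ℝ} (hβ : Measurable β) (h0 : ∀ x, 0 ≤ β x) (h1 : ∀ x, β x ≤ 1)
    (hG : Integrable G μ) (hG0 : ∀ x, β x = 0 → G x = 0)
    (hmom : ∀ l : ℕ, 1 ≤ l → ∫ x, G x * (β x : ℂ) ^ l ∂μ = 0) : ∫ x, G x ∂μ = 0 := by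
  have hb1 : ∀ x, ‖(β x : ℂ)‖ ≤ 1 := fun x => by
    rw [Complex.norm_real, Real.norm_of_nonneg (h0 x)]; exact h1 x
  have hb2 : ∀ x, ‖(1 - β x : ℂ)‖ ≤ 1 := fun x => by
    rw [← Complex.ofReal_one, ← Complex.ofReal_sub, Complex.norm_real,
      Real.norm_of_nonneg (by linarith [h1 x])]
    linarith [h0 x]
  have hint : ∀ N l : ℕ, Integrable (fun x => G x * ((1 - β x : ℂ) ^ N * (β x : ℂ) ^ l)) μ := by
    intro N l
    refine hG.mul_bdd (c := 1) (Measurable.aestronglyMeasurable (by fun_prop))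
      (Eventually.of_forall fun x => ?_)
    rw [norm_mul, norm_pow, norm_pow]
    exact mul_le_one₀ (pow_le_one₀ (norm_nonneg _) (hb2 x)) (by positivity)
      (pow_le_one₀ (norm_nonneg _) (hb1 x))
  -- Expanding one factor 1 - β at a time, every integral that retains a factor β vanishes. Hence ∫
  -- G(1-β)^N does not depend on N.
  have hz : ∀ N l : ℕ, 1 ≤ l → ∫ x, G x * ((1 - β x : ℂ) ^ N * (β x : ℂ) ^ l) ∂μ = 0 := by
    intro N
    induction N with
    | zero => intro l hl; simpa using hmom l hl
    | succ N ih =>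
      intro l hl
      have : ∀ x, G x * ((1 - β x : ℂ) ^ (N + 1) * (β x : ℂ) ^ l) =
          G x * ((1 - β x : ℂ) ^ N * (β x : ℂ) ^ l) -
            G x * ((1 - β x : ℂ) ^ N * (β x : ℂ) ^ (l + 1)) := fun x => by ring
      simp_rw [this]
      rw [integral_sub (hint N l) (hint N (l + 1)), ih l hl, ih (l + 1) (by omega), sub_zero]
  have hconst : ∀ N : ℕ, ∫ x, G x * (1 - β x : ℂ) ^ N ∂μ = ∫ x, G x ∂μ := by
    intro N
    induction N with
    | zero => simp
    | succ N ih =>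
      have : ∀ x, G x * (1 - β x : ℂ) ^ (N + 1) =
          G x * ((1 - β x : ℂ) ^ N * (β x : ℂ) ^ 0) -
            G x * ((1 - β x : ℂ) ^ N * (β x : ℂ) ^ 1) := fun x => by ring
      simp_rw [this]
      rw [integral_sub (hint N 0) (hint N 1), hz N 1 le_rfl, sub_zero]
      simpa using ih
  have hlim : Tendsto (fun N : ℕ => ∫ x, G x * (1 - β x : ℂ) ^ N ∂μ) atTop
      (𝓝 (∫ _, (0 : ℂ) ∂μ)) := by
    refine tendsto_integral_of_dominated_convergence (fun x => ‖G x‖) (fun N => ?_) hG.norm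
      (fun N => Eventually.of_forall fun x => ?_) (Eventually.of_forall fun x => ?_)
    · simpa using (hint N 0).aestronglyMeasurable
    · rw [norm_mul, norm_pow]
      exact mul_le_of_le_one_right (norm_nonneg _) (pow_le_one₀ (norm_nonneg _) (hb2 x))
    -- Where β = 0 the power (1-β)^N does not decay; there G itself vanishes.
    · rcases (h0 x).eq_or_lt with h | h
      · simp [hG0 x h.symm]
      · have : ‖(1 - β x : ℂ)‖ < 1 := by
          rw [← Complex.ofReal_one, ← Complex.ofReal_sub, Complex.norm_real,
            Real.norm_of_nonneg (by linarith [h1 x])]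
          linarith
        simpa using (tendsto_pow_atTop_nhds_zero_of_norm_lt_one this).const_mul (G x)
  simp_rw [hconst] at hlim
  simpa using tendsto_nhds_unique tendsto_const_nhds hlim

variable {f : D → ℂ} {k : ℕ} {M : ℝ}

include hD in
-- The squared integrand is at most M 𝒦(p,p)^k β^k. For k ≥ 2 and β ≤ 1 this is at most M 𝒦(p,p)^k
-- β², so the integrand is dominated by a multiple of the integrable β.
theorem norm_mul_bergmanKernel_pow_le (hk : 2 ≤ k) (hM : ∀ w, ‖f w‖ ^ 2 ≤ M * bergmanDiag w ^ k)
    (p w : D) : ‖f w * bergmanKernel D p w ^ k * ((bergmanDiag w ^ k)⁻¹ : ℝ)‖ ≤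
      √(M * bergmanDiag p ^ k) * berezin p w := by
  have hp := bergmanDiag_pos hD.isOpen hD.isBounded p
  have hw := bergmanDiag_pos hD.isOpen hD.isBounded w
  have hβ0 := berezin_nonneg hD.isOpen hD.isBounded p w
  have hβ1 := berezin_le_one hD.isOpen hD.isBounded p w
  have hM0 : 0 ≤ M := nonneg_of_mul_nonneg_left ((sq_nonneg _).trans (hM p)) (pow_pos hp k)
  refine le_of_sq_le_sq ?_ (by positivity)
  rw [mul_pow (√_), Real.sq_sqrt (by positivity), norm_mul, norm_mul, norm_pow, mul_pow, mul_pow,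
    (isReproducingKernel_bergmanKernel hD.isOpen).norm_comm p w, ← pow_mul, mul_comm k 2, pow_mul,
    norm_sq_bergmanKernel hD.isOpen hD.isBounded, Complex.norm_real,
    Real.norm_of_nonneg (by positivity)]
  calc ‖f w‖ ^ 2 * (berezin p w * (bergmanDiag p * bergmanDiag w)) ^ k *
        (bergmanDiag w ^ k)⁻¹ ^ 2
      ≤ (M * bergmanDiag w ^ k) * (berezin p w * (bergmanDiag p * bergmanDiag w)) ^ k *
        (bergmanDiag w ^ k)⁻¹ ^ 2 := by gcongr; exact hM w
    _ = M * bergmanDiag p ^ k * berezin p w ^ k := by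
        rw [mul_pow, mul_pow]
        field_simp
    _ ≤ M * bergmanDiag p ^ k * berezin p w ^ 2 := by
        gcongr ?_ * ?_
        exact pow_le_pow_of_le_one hβ0 hβ1 hk

include hD in
theorem integrable_mul_bergmanKernel_pow (hk : 2 ≤ k) (hf : IsHolomorphic f)
    (hM : ∀ w, ‖f w‖ ^ 2 ≤ M * bergmanDiag w ^ k) (p : D) :
    Integrable (fun w => f w * bergmanKernel D p w ^ k * ((bergmanDiag w ^ k)⁻¹ : ℝ))
      (invVolume D) := by
  have hm := measurable_bergmanDiag hD.isOpen
  have hK := isReproducingKernel_bergmanKernel hD.isOpen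
  have hfm := hf.continuous.measurable
  have hKm : Measurable fun w => bergmanKernel D p w := by
    simp_rw [hK.hermitian p]
    exact (Complex.continuous_conj.comp (hK.holo p).continuous).measurable
  refine ((integrable_berezin hD.isOpen hD.isBounded p).const_mul
    (√(M * bergmanDiag p ^ k))).mono' (Measurable.aestronglyMeasurable (by fun_prop))
    (Eventually.of_forall (norm_mul_bergmanKernel_pow_le hD hk hM p))

include hD in
-- This is the weight k+l reproducing formula for f 𝒦(·,p)^l at p. The extra l factors of both
-- kernels and of the weight combine to β^l, after division by 𝒦(p,p)^l.
theorem moment_eq (hf : IsHolomorphic f) (hM : ∀ w, ‖f w‖ ^ 2 ≤ M * bergmanDiag w ^ k)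
    (p : D) {l : ℕ} (hl : 1 ≤ l) :
    bergmanConst D (k + l) * ∫ w, f w * bergmanKernel D p w ^ k * ((bergmanDiag w ^ k)⁻¹ : ℝ) *
      (berezin p w : ℂ) ^ l ∂(invVolume D) = f p := by
  have hpos := bergmanDiag_pos hD.isOpen hD.isBounded
  have hK := isReproducingKernel_bergmanKernel hD.isOpen
  have hL := (isReproducingKernel_bergmanConst hD (k := k + l) (by omega)).2
  have h1 := hL.reproducing _ (hf.mul ((hK.holo p).pow l))
    (memLp_mul_bergmanKernel_pow hD.isOpen hD.isBounded hf hM p hl) p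
  have hp0 : (bergmanDiag p : ℂ) ^ l ≠ 0 :=
    pow_ne_zero l (Complex.ofReal_ne_zero.2 (hpos p).ne')
  rw [integral_weightVolume hD.isOpen hD.isBounded, ← ofReal_bergmanDiag hD.isOpen] at h1
  refine mul_right_cancel₀ hp0 ?_
  rw [h1, ← integral_const_mul, ← integral_mul_const]
  refine integral_congr_ae (Eventually.of_forall fun w => ?_)
  have hw0 := Complex.ofReal_ne_zero.2 (hpos w).ne'
  have hp0' := Complex.ofReal_ne_zero.2 (hpos p).ne'
  have hβ : (berezin p w : ℂ) * bergmanDiag p = bergmanKernel D w p * bergmanKernel D p w *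
      (bergmanDiag w : ℂ)⁻¹ := by
    rw [hK.hermitian p w, Complex.mul_conj, Complex.normSq_eq_norm_sq, berezin]
    push_cast
    field_simp
  simp only
  rw [mul_assoc, mul_assoc, ← mul_pow, hβ]
  push_cast
  rw [mul_pow, mul_pow, pow_add, pow_add, mul_inv, inv_pow]
  ring

include hD in
/-- The reproducing formula for holomorphic functions with `|f|² ≤ M 𝒦(w,w)^k`. -/
theorem reproducing_of_norm_sq_le (hk : 2 ≤ k) (hf : IsHolomorphic f)
    (hM : ∀ w, ‖f w‖ ^ 2 ≤ M * bergmanDiag w ^ k) (p : D) :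
    bergmanConst D k * ∫ w, f w * bergmanKernel D p w ^ k * ((bergmanDiag w ^ k)⁻¹ : ℝ)
      ∂(invVolume D) = f p := by
  have hpos := bergmanDiag_pos hD.isOpen hD.isBounded
  have hK := isReproducingKernel_bergmanKernel hD.isOpen
  -- the same data for `𝒦(·,p)^k`
  have hM₀ : ∀ w, ‖bergmanKernel D w p ^ k‖ ^ 2 ≤ bergmanDiag p ^ k * bergmanDiag w ^ k := by
    intro w
    rw [norm_pow, ← pow_mul, mul_comm k 2, pow_mul, ← mul_pow, mul_comm (bergmanDiag p)]
    gcongr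
    exact hK.norm_sq_le w p
  have hf₀ := (hK.holo p).pow k
  set F : D → ℂ := fun w => f w * bergmanKernel D p w ^ k * ((bergmanDiag w ^ k)⁻¹ : ℝ) with hF
  set F₀ : D → ℂ := fun w => bergmanKernel D w p ^ k * bergmanKernel D p w ^ k *
    ((bergmanDiag w ^ k)⁻¹ : ℝ) with hF₀
  have hFi : Integrable F (invVolume D) := integrable_mul_bergmanKernel_pow hD hk hf hM p
  have hFi₀ : Integrable F₀ (invVolume D) := integrable_mul_bergmanKernel_pow hD hk hf₀ hM₀ p
  have hd0 : bergmanKernel D p p ^ k ≠ 0 := by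
    rw [← ofReal_bergmanDiag hD.isOpen]
    exact pow_ne_zero k (Complex.ofReal_ne_zero.2 (hpos p).ne')
  -- With this scalar, f and a𝒦(·,p)^k agree at p. Their moments depend only on the value at p, so
  -- they coincide for every l ≥ 1.
  set a : ℂ := f p / bergmanKernel D p p ^ k with ha
  have hbdd : ∀ l : ℕ, ∀ G : D → ℂ, Integrable G (invVolume D) →
      Integrable (fun w => G w * (berezin p w : ℂ) ^ l) (invVolume D) := by
    intro l G hG
    have := measurable_berezin hD.isOpen p
    refine hG.mul_bdd (c := 1) (Measurable.aestronglyMeasurable (by fun_prop))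
      (Eventually.of_forall fun w => ?_)
    rw [norm_pow, Complex.norm_real, Real.norm_of_nonneg (berezin_nonneg hD.isOpen hD.isBounded p w)]
    exact pow_le_one₀ (berezin_nonneg hD.isOpen hD.isBounded p w)
      (berezin_le_one hD.isOpen hD.isBounded p w)
  have hzero : ∫ w, (F w - a * F₀ w) ∂(invVolume D) = 0 := by
    refine integral_eq_zero_of_moments (measurable_berezin hD.isOpen p)
      (berezin_nonneg hD.isOpen hD.isBounded p) (berezin_le_one hD.isOpen hD.isBounded p)
      (hFi.sub (hFi₀.const_mul a)) (fun w hw => ?_) fun l hl => ?_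
    · have h1 : bergmanKernel D w p = 0 := by
        have := norm_sq_bergmanKernel hD.isOpen hD.isBounded p w
        rw [hw, zero_mul] at this
        simpa using this
      have h2 : bergmanKernel D p w = 0 := by rw [hK.hermitian, h1, map_zero]
      simp [hF, hF₀, h1, h2, show k ≠ 0 by omega]
    · have h1 := moment_eq hD hf hM p hl
      have h2 := moment_eq hD hf₀ hM₀ p hl
      have hc : (bergmanConst D (k + l) : ℂ) ≠ 0 := Complex.ofReal_ne_zero.2
        (isReproducingKernel_bergmanConst hD (k := k + l) (by omega)).1.ne'
      have e : ∀ w, (F w - a * F₀ w) * (berezin p w : ℂ) ^ l =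
          F w * (berezin p w : ℂ) ^ l - a * (F₀ w * (berezin p w : ℂ) ^ l) := fun w => by ring
      simp_rw [e]
      rw [integral_sub (hbdd l F hFi) ((hbdd l F₀ hFi₀).const_mul a), integral_const_mul]
      refine mul_left_cancel₀ hc ?_
      rw [mul_zero, mul_sub, mul_left_comm, h1, h2, ha, div_mul_cancel₀ _ hd0, sub_self]
  -- The comparison function 𝒦(·,p)^k is square integrable of weight k, so the ordinary formula
  -- evaluates ∫ F₀.
  have hL := (isReproducingKernel_bergmanConst hD (k := k) (by omega)).2
  have hmem := memLp_mul_bergmanKernel_pow hD.isOpen hD.isBounded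
    (isHolomorphic_const (1 : ℂ)) (k := 0) (M := 1) (by simp) p (l := k) (by omega)
  simp only [zero_add, one_mul] at hmem
  have h3 := hL.reproducing _ hf₀ hmem p
  rw [integral_weightVolume hD.isOpen hD.isBounded] at h3
  have h4 : (bergmanConst D k : ℂ) * ∫ w, F₀ w ∂(invVolume D) = bergmanKernel D p p ^ k := by
    rw [h3, ← integral_const_mul]
    refine integral_congr_ae (Eventually.of_forall fun w => ?_)
    simp only [hF₀]
    ring
  rw [integral_sub hFi (hFi₀.const_mul a), integral_const_mul, sub_eq_zero] at hzero
  rw [hzero, mul_left_comm, h4, ha, div_mul_cancel₀ _ hd0]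

end Reproducing

/-! ### Proper discontinuity and fundamental domains -/

section Discontinuity

open Metric Set Filter

variable {n : ℕ} {D : Set (Fin n → ℂ)}

/-- The Carathéodory type pseudo-distance of `z` and `w` is at most `ε`: holomorphic functions
bounded by one differ by at most `ε` at `z` and `w`. -/
def CaraClose (ε : ℝ) (z w : D) : Prop :=
  ∀ f : D → ℂ, IsHolomorphic f → (∀ x, ‖f x‖ ≤ 1) → ‖f z - f w‖ ≤ ε

theorem CaraClose.symm {ε : ℝ} {z w : D} (h : CaraClose ε z w) : CaraClose ε w z :=
  fun f hf hb => by rw [norm_sub_rev]; exact h f hf hb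

theorem CaraClose.trans {ε δ : ℝ} {x y z : D} (h : CaraClose ε x y) (h' : CaraClose δ y z) :
    CaraClose (ε + δ) x z := fun f hf hb =>
  (norm_sub_le_norm_sub_add_norm_sub _ (f y) _).trans (add_le_add (h f hf hb) (h' f hf hb))

theorem CaraClose.mono {ε δ : ℝ} {x y : D} (h : CaraClose ε x y) (hεδ : ε ≤ δ) :
    CaraClose δ x y := fun f hf hb => (h f hf hb).trans hεδ

theorem CaraClose.smul {ε : ℝ} {z w : D} (h : CaraClose ε z w) (g : Aut D) :
    CaraClose ε (g • z) (g • w) := fun f hf hb =>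
  h (fun x => f (g • x)) (hf.comp_smul g) fun _ => hb _

theorem caraClose_smul_iff {ε : ℝ} {z w : D} (g : Aut D) :
    CaraClose ε (g • z) (g • w) ↔ CaraClose ε z w :=
  ⟨fun h => by simpa using h.smul g⁻¹, fun h => h.smul g⟩

/-- The coordinate functions divided by a bound R for D are admissible test functions. -/
theorem exists_dist_le_of_caraClose (hb : Bornology.IsBounded D) : ∃ R > 0,
    ∀ {ε : ℝ} {z w : D}, 0 ≤ ε → CaraClose ε z w → dist z w ≤ R * ε := by
  obtain ⟨R, hR, hRD⟩ := hb.exists_pos_norm_le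
  refine ⟨R, hR, fun {ε z w} hε h => ?_⟩
  rw [Subtype.dist_eq, dist_pi_le_iff (by positivity)]
  intro i
  have hc : IsHolomorphic fun x : D => ((R : ℂ)⁻¹ * (x : Fin n → ℂ) i) :=
    isHolomorphic_of_eqOn (u := fun x => (R : ℂ)⁻¹ * x i) (by fun_prop) fun x => rfl
  have h1 := h _ hc fun x => by
    rw [norm_mul, norm_inv, Complex.norm_real, Real.norm_of_nonneg hR.le, inv_mul_le_iff₀ hR,
      mul_one]
    exact (norm_le_pi_norm _ i).trans (hRD _ x.2)
  rw [← mul_sub, norm_mul, norm_inv, Complex.norm_real, Real.norm_of_nonneg hR.le,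
    inv_mul_le_iff₀ hR] at h1
  rwa [dist_eq_norm]

/-- The Schwarz lemma controls all holomorphic functions bounded by one simultaneously on a ball
inside D. -/
theorem eventually_caraClose (hD : IsOpen D) (z : D) {ε : ℝ} (hε : 0 < ε) :
    ∀ᶠ w in 𝓝 z, CaraClose ε w z := by
  obtain ⟨r, hr, hrD⟩ := Metric.isOpen_iff.1 hD z z.2
  have h1 : ∀ᶠ w : D in 𝓝 z, dist w z < min r (ε * r / 2) :=
    ball_mem_nhds z (lt_min hr (by positivity))
  filter_upwards [h1] with w hw f hf hb
  have hwr : (w : Fin n → ℂ) ∈ ball (z : Fin n → ℂ) r :=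
    (lt_min_iff.1 hw).1
  have := Complex.dist_le_div_mul_dist_of_mapsTo_ball (R₂ := 2)
    (f := Function.extend Subtype.val f 0) (DifferentiableOn.mono hf hrD) (fun y hy => ?_) hwr
  · rw [extend_coe, extend_coe, dist_eq_norm] at this
    refine this.trans ?_
    have h2 := (lt_min_iff.1 hw).2
    rw [Subtype.dist_eq] at h2
    rw [div_mul_eq_mul_div, div_le_iff₀ hr]
    linarith
  · have e := extend_coe f ⟨y, hrD hy⟩
    simp only at e
    rw [mem_closedBall, extend_coe, e, dist_eq_norm]
    linarith [norm_sub_le (f ⟨y, hrD hy⟩) (f z), hb ⟨y, hrD hy⟩, hb z]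

/-- A Euclidean ball works at one base point, and transitivity carries it to any other. Invariance
of the relation makes ε independent of z. -/
theorem exists_isCompact_caraClose (hD : IsBoundedSymmetricDomain D) : ∃ ε > 0, ∀ z : D,
    ∃ C : Set D, IsCompact C ∧ ∀ w, CaraClose ε w z → w ∈ C := by
  obtain ⟨p, hp⟩ := hD.isConnected.nonempty
  lift p to D using hp
  obtain ⟨R, hR, hdist⟩ := exists_dist_le_of_caraClose hD.isBounded
  obtain ⟨r, hr, -, hc⟩ := exists_isCompact_closedBall hD.isOpen p
  refine ⟨r / R, by positivity, fun z => ?_⟩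
  obtain ⟨g, rfl⟩ := hD.transitive p z
  refine ⟨_, hc.image (continuous_aut_smul g), fun w hw => ⟨g⁻¹ • w, ?_, smul_inv_smul g w⟩⟩
  have h1 : CaraClose (r / R) (g⁻¹ • w) p := by
    rwa [← caraClose_smul_iff g, smul_inv_smul]
  have := hdist (by positivity) h1
  rwa [mul_div_cancel₀ _ hR.ne'] at this

/-- If an ultrafilter of automorphisms converges at one point then it converges everywhere. -/
theorem exists_tendsto_smul (hD : IsBoundedSymmetricDomain D) (𝒰 : Ultrafilter (Aut D)) {p q : D}
    (hp : Tendsto (fun g : Aut D => g • p) 𝒰 (𝓝 q)) (z : D) :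
    ∃ y : D, Tendsto (fun g : Aut D => g • z) 𝒰 (𝓝 y) := by
  obtain ⟨ε, hε, hcpt⟩ := exists_isCompact_caraClose hD
  have : PreconnectedSpace D := isPreconnected_iff_preconnectedSpace.1 hD.isConnected.isPreconnected
  -- Automorphisms preserve closeness, so g • w eventually stays in a compact set around the limit
  -- y. Since ε/2 is the same at every point, the set of points of convergence is both open and
  -- closed.
  have hstep : ∀ z w y : D, Tendsto (fun g : Aut D => g • z) 𝒰 (𝓝 y) → CaraClose (ε / 2) w z →
      ∃ y' : D, Tendsto (fun g : Aut D => g • w) 𝒰 (𝓝 y') := by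
    intro z w y hy hwz
    obtain ⟨C, hC, hCy⟩ := hcpt y
    have h1 : ∀ᶠ g : Aut D in 𝒰, g • w ∈ C := by
      filter_upwards [hy.eventually (eventually_caraClose hD.isOpen y (half_pos hε))] with g hg
      exact hCy _ (by simpa using (hwz.smul g).trans hg)
    obtain ⟨y', -, hy'⟩ := hC.ultrafilter_le_nhds (𝒰.map fun g => g • w)
      (le_principal_iff.2 h1)
    exact ⟨y', hy'⟩
  have hclopen : IsClopen {z : D | ∃ y : D, Tendsto (fun g : Aut D => g • z) 𝒰 (𝓝 y)} := by
    constructor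
    · rw [← isOpen_compl_iff, isOpen_iff_mem_nhds]
      intro z hz
      filter_upwards [eventually_caraClose hD.isOpen z (half_pos hε)] with w hw
      rintro ⟨y, hy⟩
      exact hz (hstep w z y hy hw.symm)
    · rw [isOpen_iff_mem_nhds]
      rintro z ⟨y, hy⟩
      filter_upwards [eventually_caraClose hD.isOpen z (half_pos hε)] with w hw
      exact hstep z w y hy hw
  have := hclopen.eq_univ ⟨p, q, hp⟩
  have hz : z ∈ {z : D | ∃ y : D, Tendsto (fun g : Aut D => g • z) 𝒰 (𝓝 y)} := by
    rw [this]
    exact mem_univ z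
  exact hz

/-- Two elements far along 𝒰 send z near the same limit, so by invariance their quotient nearly
fixes z and hence nearly fixes points near z. Locally uniform convergence to the identity is
convergence in the compact-open topology. -/
theorem tendsto_inv_mul (hD : IsBoundedSymmetricDomain D) {Γ : Subgroup (Aut D)}
    (𝒰 : Ultrafilter Γ) (h : ∀ z : D, ∃ y : D, Tendsto (fun g : Γ => g • z) 𝒰 (𝓝 y)) :
    Tendsto (fun q : Γ × Γ => q.1⁻¹ * q.2) ((𝒰 : Filter Γ) ×ˢ (𝒰 : Filter Γ)) (𝓝 1) := by
  have : LocallyCompactSpace D := hD.isOpen.locallyCompactSpace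
  have hind : Topology.IsInducing fun γ : Γ => Aut.toContinuousMap (γ : Aut D) :=
    (Topology.IsInducing.mk rfl : Topology.IsInducing (Aut.toContinuousMap (D := D))).comp
      Topology.IsInducing.subtypeVal
  rw [hind.tendsto_nhds_iff, ContinuousMap.tendsto_iff_tendstoLocallyUniformly,
    Metric.tendstoLocallyUniformly_iff]
  intro ε hε z
  obtain ⟨R, hR, hdist⟩ := exists_dist_le_of_caraClose hD.isBounded
  obtain ⟨δ, hδ, hδε⟩ : ∃ δ > 0, R * (4 * δ) < ε :=
    ⟨ε / (8 * R), by positivity, by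
      rw [show R * (4 * (ε / (8 * R))) = ε / 2 by field_simp; norm_num]
      linarith⟩
  obtain ⟨y, hy⟩ := h z
  refine ⟨_, eventually_caraClose hD.isOpen z hδ, ?_⟩
  have hy' := hy.eventually (eventually_caraClose hD.isOpen y hδ)
  filter_upwards [hy'.prod_mk hy'] with q hq x hx
  have hx : CaraClose δ x z := hx
  have h1 : CaraClose (2 * δ) (q.2 • z) (q.1 • z) :=
    (hq.2.trans hq.1.symm).mono (by linarith)
  have h2 : CaraClose (2 * δ) ((q.1⁻¹ * q.2) • z) z := by
    have h2 : CaraClose _ ((q.1⁻¹ : Γ) • q.2 • z) ((q.1⁻¹ : Γ) • q.1 • z) :=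
      h1.smul ((q.1⁻¹ : Γ) : Aut D)
    rwa [inv_smul_smul, smul_smul] at h2
  have h3 : CaraClose δ ((q.1⁻¹ * q.2) • x) ((q.1⁻¹ * q.2) • z) :=
    hx.smul ((q.1⁻¹ * q.2 : Γ) : Aut D)
  have h4 : CaraClose (4 * δ) x ((q.1⁻¹ * q.2) • x) :=
    (hx.trans (h3.trans h2).symm).mono (by linarith)
  have h5 := hdist (by positivity) h4
  refine lt_of_le_of_lt ?_ hδε
  have e : Aut.toContinuousMap ((1 : Γ) : Aut D) x = x := one_smul (Aut D) x
  rw [e]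
  exact h5

/-- A discrete group of automorphisms acts properly discontinuously. -/
theorem exists_nhds_finite_smul_mem (hD : IsBoundedSymmetricDomain D) {Γ : Subgroup (Aut D)}
    [DiscreteTopology Γ] (p : D) :
    ∃ U ∈ 𝓝 p, {γ : Γ | ∃ z ∈ U, γ • z ∈ U}.Finite := by
  obtain ⟨ε, hε, hcpt⟩ := exists_isCompact_caraClose hD
  obtain ⟨C, hC, hCp⟩ := hcpt p
  refine ⟨_, eventually_caraClose hD.isOpen p (half_pos hε), ?_⟩
  have hsub : {γ : Γ | ∃ z ∈ {w | CaraClose (ε / 2) w p}, γ • z ∈ {w | CaraClose (ε / 2) w p}} ⊆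
      {γ : Γ | γ • p ∈ C} := by
    rintro γ ⟨z, hz, hγz⟩
    refine hCp _ ?_
    have h1 : CaraClose (ε / 2) (γ • p) (γ • z) := (CaraClose.symm hz).smul (γ : Aut D)
    simpa using h1.trans hγz
  refine Set.Finite.subset ?_ hsub
  by_contra hinf
  -- An infinite return set carries a nonprincipal ultrafilter. Along it the orbit of p converges in
  -- C, so quotients tend to 1. Discreteness makes them eventually equal to 1, which forces a set of
  -- 𝒰 to be a singleton at most.
  have hne : NeBot (cofinite ⊓ 𝓟 {γ : Γ | γ • p ∈ C}) := by
    rw [cofinite_inf_principal_neBot_iff]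
    exact hinf
  set 𝒰 := Ultrafilter.of (cofinite ⊓ 𝓟 {γ : Γ | γ • p ∈ C})
  have hle : (𝒰 : Filter Γ) ≤ _ := Ultrafilter.of_le _
  have hpC : ∀ᶠ γ in (𝒰 : Filter Γ), γ • p ∈ C := hle (mem_inf_of_right (mem_principal_self _))
  obtain ⟨q, -, hq⟩ := hC.ultrafilter_le_nhds (𝒰.map fun γ => γ • p) (le_principal_iff.2 hpC)
  have hlim : ∀ z : D, ∃ y : D, Tendsto (fun g : Γ => g • z) 𝒰 (𝓝 y) := by
    intro z
    obtain ⟨y, hy⟩ := exists_tendsto_smul hD (𝒰.map Subtype.val) (p := p) (q := q) hq z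
    exact ⟨y, hy⟩
  have h1 := tendsto_inv_mul hD 𝒰 hlim
  have h2 : ∀ᶠ q : Γ × Γ in (𝒰 : Filter Γ) ×ˢ (𝒰 : Filter Γ), q.1⁻¹ * q.2 = 1 :=
    h1.eventually (p := fun γ => γ = 1) ((isOpen_discrete {(1 : Γ)}).mem_nhds rfl)
  obtain ⟨T, hT, hTT⟩ := Filter.mem_prod_same_iff.1 h2
  have hTs : T.Subsingleton := fun a ha b hb => by
    have : a⁻¹ * b = 1 := hTT (mk_mem_prod ha hb)
    exact inv_mul_eq_one.1 this
  have hTc : Tᶜ ∈ (𝒰 : Filter Γ) :=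
    hle (mem_inf_of_left (by rw [mem_cofinite, compl_compl]; exact hTs.finite))
  exact 𝒰.compl_notMem_iff.2 hT hTc

/-- Only finitely many elements return to a small neighbourhood. Each nontrivial one moves p by
freeness, so shrinking finitely often excludes them all. -/
theorem exists_nhds_smul_notMem (hD : IsBoundedSymmetricDomain D) {Γ : Subgroup (Aut D)}
    (hΓ : IsSmoothCocompactLattice Γ) (p : D) :
    ∃ U : Set D, IsOpen U ∧ p ∈ U ∧ ∀ γ : Γ, ∀ z ∈ U, γ • z ∈ U → γ = 1 := by
  have := hΓ.discrete
  obtain ⟨V, hV, hfin⟩ := exists_nhds_finite_smul_mem hD (Γ := Γ) p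
  have hsep : ∀ γ : Γ, γ ≠ 1 → ∃ W ∈ 𝓝 p, ∀ z ∈ W, γ • z ∉ W := by
    intro γ hγ
    have hne : γ • p ≠ p := fun h => hγ (hΓ.free γ p h)
    obtain ⟨A, B, hA, hB, hpA, hpB, hAB⟩ := t2_separation hne
    have hcont : Continuous fun z : D => γ • z := continuous_aut_smul (γ : Aut D)
    refine ⟨(fun z => γ • z) ⁻¹' A ∩ B, inter_mem (hcont.continuousAt (hA.mem_nhds hpA))
      (hB.mem_nhds hpB), fun z hz hγz => ?_⟩
    exact hAB.le_bot ⟨hz.1, hγz.2⟩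
  choose! W hW hWsep using hsep
  have hmem : V ∩ ⋂ γ ∈ {γ : Γ | γ ≠ 1 ∧ ∃ z ∈ V, γ • z ∈ V}, W γ ∈ 𝓝 p := by
    refine inter_mem hV ((biInter_mem (hfin.subset fun γ hγ => hγ.2)).2 fun γ hγ => hW γ hγ.1)
  obtain ⟨U, hUs, hUo, hpU⟩ := _root_.mem_nhds_iff.1 hmem
  refine ⟨U, hUo, hpU, fun γ z hz hγz => ?_⟩
  by_contra hγ
  have hmem : γ ∈ {γ : Γ | γ ≠ 1 ∧ ∃ z ∈ V, γ • z ∈ V} := ⟨hγ, z, (hUs hz).1, (hUs hγz).1⟩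
  exact hWsep γ hγ z (mem_iInter₂.1 (hUs hz).2 γ hmem) (mem_iInter₂.1 (hUs hγz).2 γ hmem)

/-- The group embeds topologically in the second countable space C(D, D), and a discrete second
countable space is countable. -/
theorem countable_of_discrete (hD : IsOpen D) {Γ : Subgroup (Aut D)} [DiscreteTopology Γ] :
    Countable Γ := by
  have : LocallyCompactSpace D := hD.locallyCompactSpace
  have hind : Topology.IsInducing fun γ : Γ => Aut.toContinuousMap (γ : Aut D) :=
    (Topology.IsInducing.mk rfl : Topology.IsInducing (Aut.toContinuousMap (D := D))).comp
      Topology.IsInducing.subtypeVal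
  have : SecondCountableTopology Γ := hind.secondCountableTopology
  exact countable_of_Lindelof_of_discrete

/-- A free properly discontinuous action has a measurable fundamental domain. -/
theorem exists_isFundamentalDomain (hD : IsBoundedSymmetricDomain D) {Γ : Subgroup (Aut D)}
    (hΓ : IsSmoothCocompactLattice Γ) (μ : Measure D) :
    ∃ 𝓕 : Set D, IsFundamentalDomain Γ 𝓕 μ := by
  have := hΓ.discrete
  have : Countable Γ := countable_of_discrete hD.isOpen
  choose U hUo hpU hU using exists_nhds_smul_notMem hD hΓ
  obtain ⟨T, hTc, hTU⟩ := TopologicalSpace.countable_cover_nhds fun p => (hUo p).mem_nhds (hpU p)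
  obtain ⟨p₀, hp₀⟩ := hD.isConnected.nonempty
  have hTne : T.Nonempty := by
    by_contra h
    rw [not_nonempty_iff_eq_empty.1 h] at hTU
    have h2 : (⟨p₀, hp₀⟩ : D) ∈ ⋃ x ∈ (∅ : Set D), U x := by
      rw [hTU]
      exact mem_univ _
    simp at h2
  obtain ⟨t, ht⟩ := hTc.exists_eq_range hTne
  set S : ℕ → Set D := fun i => ⋃ γ : Γ, (fun z => γ • z) ⁻¹' U (t i) with hS
  have hSo : ∀ i, IsOpen (S i) := fun i => isOpen_iUnion fun γ =>
    (hUo (t i)).preimage (continuous_aut_smul (γ : Aut D))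
  have hSinv : ∀ i (γ : Γ) z, γ • z ∈ S i ↔ z ∈ S i := by
    intro i γ z
    simp only [hS, mem_iUnion, mem_preimage]
    constructor
    · rintro ⟨δ, hδ⟩
      exact ⟨δ * γ, by rwa [mul_smul]⟩
    · rintro ⟨δ, hδ⟩
      exact ⟨δ * γ⁻¹, by rwa [mul_smul, inv_smul_smul]⟩
  have hcov : ∀ z, ∃ i, z ∈ S i := by
    intro z
    have : z ∈ ⋃ x ∈ T, U x := hTU.symm ▸ mem_univ z
    rw [ht] at this
    simp only [mem_range, iUnion_exists, iUnion_iUnion_eq', mem_iUnion] at this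
    obtain ⟨i, hi⟩ := this
    exact ⟨i, mem_iUnion.2 ⟨1, by simpa using hi⟩⟩
  classical
  -- From each U(t i) the points whose orbit meets an earlier U(t j) are removed. An orbit then
  -- meets 𝓕 only at its first level, and there only once.
  set 𝓕 : Set D := ⋃ i, U (t i) \ ⋃ j ∈ Finset.range i, S j with h𝓕
  have hlevel : ∀ z i, z ∈ U (t i) \ ⋃ j ∈ Finset.range i, S j → i = Nat.find (hcov z) := by
    intro z i hz
    refine ((Nat.find_eq_iff (hcov z)).2 ⟨mem_iUnion.2 ⟨1, by simpa using hz.1⟩,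
      fun j hj hjz => ?_⟩).symm
    exact hz.2 (mem_iUnion₂.2 ⟨j, Finset.mem_range.2 hj, hjz⟩)
  refine ⟨𝓕, IsFundamentalDomain.mk' ?_ fun z => ?_⟩
  · refine (MeasurableSet.iUnion fun i => (hUo _).measurableSet.diff ?_).nullMeasurableSet
    exact Finset.measurableSet_biUnion _ fun j _ => (hSo j).measurableSet
  · have hz := Nat.find_spec (hcov z)
    have hmin := fun j => Nat.find_min (hcov z) (m := j)
    have hfind : ∀ γ : Γ, Nat.find (hcov (γ • z)) = Nat.find (hcov z) := fun γ =>
      Nat.find_congr' fun {i} => hSinv i γ z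
    obtain ⟨γ, hγ⟩ := mem_iUnion.1 hz
    refine ⟨γ, mem_iUnion.2 ⟨_, hγ, fun h => ?_⟩, fun δ hδ => ?_⟩
    · obtain ⟨j, hj, hjz⟩ := mem_iUnion₂.1 h
      exact hmin j (Finset.mem_range.1 hj) ((hSinv j γ z).1 hjz)
    · obtain ⟨i, hi⟩ := mem_iUnion.1 hδ
      have hi' := hlevel _ i hi
      rw [hfind] at hi'
      subst hi'
      have hmem : (δ * γ⁻¹) • γ • z ∈ U (t (Nat.find (hcov z))) := by
        rw [mul_smul, inv_smul_smul]
        exact hi.1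
      exact mul_inv_eq_one.1 (hU _ _ _ hγ hmem)

end Discontinuity

/-! ### Convergence and automorphy of the Poincaré series -/

section Series

open Metric Set Filter

variable {n m : ℕ} {D : Set (Fin n → ℂ)} (hD : IsBoundedSymmetricDomain D)
  {Γ : Subgroup (Aut D)} (hΓ : IsSmoothCocompactLattice Γ)

include hD hΓ in
-- Cover A by N open sets whose Γ-translates are pairwise disjoint; each contributes at most the
-- full integral.
theorem exists_tsum_setLIntegral_le {A : Set D} (hA : IsCompact A) (μ : Measure D)
    (u : D → ℝ≥0∞) : ∃ N : ℕ,
      ∑' γ : Γ, ∫⁻ z in (fun z => (γ : Aut D)⁻¹ • z) ⁻¹' A, u z ∂μ ≤ N * ∫⁻ z, u z ∂μ := by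
  have := hΓ.discrete
  have : Countable Γ := countable_of_discrete hD.isOpen
  choose U hUo hpU hU using exists_nhds_smul_notMem hD hΓ
  obtain ⟨T, -, hTA⟩ := hA.elim_nhds_subcover U fun p _ => (hUo p).mem_nhds (hpU p)
  refine ⟨T.card, ?_⟩
  have hone : ∀ p ∈ T, ∑' γ : Γ, ∫⁻ z in (fun z => (γ : Aut D)⁻¹ • z) ⁻¹' U p, u z ∂μ ≤
      ∫⁻ z, u z ∂μ := by
    intro p _
    rw [← lintegral_iUnion]
    · exact setLIntegral_le_lintegral _ _
    · exact fun γ => ((hUo p).preimage (continuous_aut_smul _)).measurableSet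
    · intro γ δ hγδ
      refine Set.disjoint_left.2 fun z hz hz' => hγδ ?_
      have h1 : (δ⁻¹ * γ) • ((γ⁻¹ : Γ) • z) ∈ U p := by
        rw [mul_smul, smul_inv_smul]
        exact hz'
      exact (inv_mul_eq_one.1 (hU p _ _ hz h1)).symm
  calc ∑' γ : Γ, ∫⁻ z in (fun z => (γ : Aut D)⁻¹ • z) ⁻¹' A, u z ∂μ
      ≤ ∑' γ : Γ, ∑ p ∈ T, ∫⁻ z in (fun z => (γ : Aut D)⁻¹ • z) ⁻¹' U p, u z ∂μ := by
        refine ENNReal.tsum_le_tsum fun γ => ?_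
        refine (lintegral_mono_set (preimage_mono hTA)).trans ?_
        rw [preimage_iUnion₂]
        have e : (⋃ p ∈ T, (fun z => (γ : Aut D)⁻¹ • z) ⁻¹' U p) =
            ⋃ p : T, (fun z => (γ : Aut D)⁻¹ • z) ⁻¹' U p := by
          ext z
          simp
        rw [e]
        refine (lintegral_iUnion_le _ _).trans (le_of_eq ?_)
        rw [tsum_fintype, Finset.sum_coe_sort T fun p =>
          ∫⁻ z in (fun z => (γ : Aut D)⁻¹ • z) ⁻¹' U p, u z ∂μ]
    _ = ∑ p ∈ T, ∑' γ : Γ, ∫⁻ z in (fun z => (γ : Aut D)⁻¹ • z) ⁻¹' U p, u z ∂μ :=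
        Summable.tsum_finsetSum fun _ _ => ENNReal.summable
    _ ≤ ∑ p ∈ T, ∫⁻ z, u z ∂μ := Finset.sum_le_sum hone
    _ = _ := by rw [Finset.sum_const, nsmul_eq_mul]

include hD hΓ in
/-- Summability of the translates of the Bergman kernel, uniformly on compact sets. -/
theorem exists_summable_norm_slash_sq_le (p : D) {A : Set D} (hA : IsCompact A) :
    ∃ u : Γ → ℝ, Summable u ∧ ∀ γ : Γ, ∀ z ∈ A,
      ‖slash 1 (γ : Aut D) (fun w => bergmanKernel D w p) z‖ ^ 2 ≤ u γ := by
  have hK := isReproducingKernel_bergmanKernel hD.isOpen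
  obtain ⟨A', hA', C, hC⟩ := exists_enorm_sq_le_setLIntegral hD.isOpen hA
  obtain ⟨N, hN⟩ := exists_tsum_setLIntegral_le hD hΓ hA' (eucVolume D)
    fun w => ‖bergmanKernel D w p‖ₑ ^ 2
  set v : Γ → ℝ≥0∞ := fun γ => ∫⁻ z in (fun z => (γ : Aut D)⁻¹ • z) ⁻¹' A',
    ‖bergmanKernel D z p‖ₑ ^ 2 ∂(eucVolume D) with hv
  have hfin : ∑' γ, v γ ≠ ∞ := by
    refine (hN.trans_lt ?_).ne
    rw [hK.lintegral_enorm_sq]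
    finiteness
  refine ⟨fun γ => C * (v γ).toReal, (ENNReal.summable_toReal hfin).mul_left _, fun γ z hz => ?_⟩
  have h1 := hC _ ((hK.holo p).slash hD.isOpen 1 (γ : Aut D)) z hz
  -- The local L² norm of the translate over A' becomes the L² mass of 𝒦(·,p) on γA', which is
  -- summable over γ.
  rw [(quasiInvariant_eucVolume hD.isOpen).lintegral_slash (γ : Aut D) (hK.holo p) A'
    hA'.measurableSet] at h1
  have hvγ : v γ ≠ ∞ := ne_top_of_le_ne_top hfin (ENNReal.le_tsum γ)
  have h2 := ENNReal.toReal_mono (ENNReal.mul_ne_top ENNReal.coe_ne_top hvγ) h1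
  rwa [ENNReal.toReal_pow, toReal_enorm, ENNReal.toReal_mul, ENNReal.coe_toReal] at h2

variable (k : ℕ) (ρ : Γ →* Matrix.unitaryGroup (Fin m) ℂ) (j : Fin m) (p : D)

/-- Only column j of ρ(γ⁻¹) enters, so the weight k term is a matrix entry times the k-th power of a
scalar weight 1 translate. -/
theorem poincareTerm_apply (γ : Γ) (z : D) (i : Fin m) :
    poincareTerm k ρ j p γ z i = bergmanConst D k * (ρ γ⁻¹ : Matrix (Fin m) (Fin m) ℂ) i j *
      slash 1 (γ : Aut D) (fun w => bergmanKernel D w p) z ^ k := by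
  simp only [poincareTerm, seed, Matrix.mulVec_single, Pi.smul_apply, Matrix.col_apply,
    MulOpposite.smul_eq_mul_unop, MulOpposite.unop_op, smul_eq_mul, slash, pow_one, mul_pow]
  rw [show ((γ : Aut D) • z : D) = γ • z from rfl]
  ring

theorem norm_poincareTerm_le (γ : Γ) (z : D) : ‖poincareTerm k ρ j p γ z‖ ≤
    |bergmanConst D k| * ‖slash 1 (γ : Aut D) (fun w => bergmanKernel D w p) z‖ ^ k := by
  refine (pi_norm_le_iff_of_nonneg (by positivity)).2 fun i => ?_
  rw [poincareTerm_apply, norm_mul, norm_mul, norm_pow, Complex.norm_real, Real.norm_eq_abs]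
  gcongr
  exact mul_le_of_le_one_right (abs_nonneg _) (entry_norm_bound_of_unitary (ρ γ⁻¹).2 i j)

include hD in
theorem norm_slash_sq_le (γ : Aut D) (z : D) :
    ‖slash 1 γ (fun w => bergmanKernel D w p) z‖ ^ 2 ≤ bergmanDiag p * bergmanDiag z := by
  rw [slash, pow_one, norm_mul, mul_pow, ← bergmanDiag_smul hD.isOpen γ z, ← mul_assoc]
  gcongr
  rw [mul_comm]
  exact (isReproducingKernel_bergmanKernel hD.isOpen).norm_sq_le _ _

include hD hΓ in
-- Two of the k factors are summable over Γ by the L² estimate; the other k - 2 are bounded on A by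
-- Cauchy–Schwarz for 𝒦.
theorem exists_summable_norm_poincareTerm_le (hk : 2 ≤ k) {A : Set D} (hA : IsCompact A) :
    ∃ u : Γ → ℝ, Summable u ∧ ∀ γ : Γ, ∀ z ∈ A, ‖poincareTerm k ρ j p γ z‖ ≤ u γ := by
  obtain ⟨u, hu, hub⟩ := exists_summable_norm_slash_sq_le hD hΓ p hA
  obtain ⟨B, hB⟩ := hA.bddAbove_image (continuous_bergmanDiag hD.isOpen).continuousOn
  have hp := bergmanDiag_pos hD.isOpen hD.isBounded p
  refine ⟨fun γ => |bergmanConst D k| * (√(bergmanDiag p * B) ^ (k - 2) * u γ),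
    (hu.mul_left _).mul_left _, fun γ z hz => (norm_poincareTerm_le k ρ j p γ z).trans ?_⟩
  have h1 : ‖slash 1 (γ : Aut D) (fun w => bergmanKernel D w p) z‖ ≤ √(bergmanDiag p * B) := by
    refine Real.le_sqrt_of_sq_le ((norm_slash_sq_le hD p (γ : Aut D) z).trans ?_)
    gcongr
    exact hB (mem_image_of_mem _ hz)
  calc |bergmanConst D k| * ‖slash 1 (γ : Aut D) (fun w => bergmanKernel D w p) z‖ ^ k
      = |bergmanConst D k| * (‖slash 1 (γ : Aut D) (fun w => bergmanKernel D w p) z‖ ^ (k - 2) *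
        ‖slash 1 (γ : Aut D) (fun w => bergmanKernel D w p) z‖ ^ 2) := by
        rw [← pow_add, Nat.sub_add_cancel hk]
    _ ≤ |bergmanConst D k| * (√(bergmanDiag p * B) ^ (k - 2) * u γ) := ?_
  gcongr
  exact hub γ z hz

include hD hΓ in
theorem hasSumUniformlyOn_poincareTerm (hk : 2 ≤ k) {A : Set D} (hA : IsCompact A) :
    HasSumUniformlyOn (fun (γ : Γ) (z : D) => poincareTerm k ρ j p γ z)
      (poincareSeries k ρ j p) A := by
  obtain ⟨u, hu, hub⟩ := exists_summable_norm_poincareTerm_le hD hΓ k ρ j p hk hA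
  exact HasSumUniformlyOn.of_norm_le_summable hu hub

include hD hΓ in
theorem summableUniformlyOn_norm_poincareTerm (hk : 2 ≤ k) {A : Set D} (hA : IsCompact A) :
    SummableUniformlyOn (fun (γ : Γ) (z : D) => ‖poincareTerm k ρ j p γ z‖) A := by
  obtain ⟨u, hu, hub⟩ := exists_summable_norm_poincareTerm_le hD hΓ k ρ j p hk hA
  exact (HasSumUniformlyOn.of_norm_le_summable hu
    fun γ z hz => by rw [norm_norm]; exact hub γ z hz).summableUniformlyOn

include hD hΓ in
theorem hasSum_poincareTerm (hk : 2 ≤ k) (z : D) :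
    HasSum (fun γ : Γ => poincareTerm k ρ j p γ z) (poincareSeries k ρ j p z) :=
  (hasSumUniformlyOn_poincareTerm hD hΓ k ρ j p hk isCompact_singleton).hasSum rfl

theorem IsHolomorphic.finset_sum {F : Type*} [NormedAddCommGroup F] [NormedSpace ℂ F] {ι : Type*}
    (s : Finset ι) {f : ι → D → F} (hf : ∀ i, IsHolomorphic (f i)) :
    IsHolomorphic fun z => ∑ i ∈ s, f i z := by
  classical
  induction s using Finset.induction_on with
  | empty => simpa using isHolomorphic_const (0 : F)
  | insert a s ha ih =>
    simp_rw [Finset.sum_insert ha]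
    exact (hf a).add ih

include hD in
theorem isHolomorphic_poincareTerm (γ : Γ) : IsHolomorphic (poincareTerm k ρ j p γ) := by
  rw [isHolomorphic_pi]
  intro i
  simp_rw [poincareTerm_apply]
  exact (isHolomorphic_const _).mul
    ((((isReproducingKernel_bergmanKernel hD.isOpen).holo p).slash hD.isOpen 1 _).pow k)

include hD hΓ in
theorem isHolomorphic_poincareSeries (hk : 2 ≤ k) : IsHolomorphic (poincareSeries k ρ j p) :=
  isHolomorphic_tendsto hD.isOpen (φ := atTop)
    (f := fun (s : Finset Γ) z => ∑ γ ∈ s, poincareTerm k ρ j p γ z)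
    (fun s => IsHolomorphic.finset_sum s fun γ => isHolomorphic_poincareTerm hD k ρ j p γ)
    fun A hA => by
      have := hasSumUniformlyOn_poincareTerm hD hΓ k ρ j p hk hA
      rw [hasSumUniformlyOn_iff_tendstoUniformlyOn] at this
      exact this

include hD in
theorem jacobian_smul_poincareTerm (γ δ : Γ) (z : D) :
    jacobian (γ : Aut D) z ^ k • poincareTerm k ρ j p δ (γ • z) =
      (ρ γ : Matrix (Fin m) (Fin m) ℂ).mulVec (poincareTerm k ρ j p (δ * γ) z) := by
  have hJ : jacobian ((δ * γ : Γ) : Aut D) z =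
      jacobian (δ : Aut D) (γ • z) * jacobian (γ : Aut D) z := jacobian_mul hD.isOpen _ _ z
  have hρ : (ρ γ : Matrix (Fin m) (Fin m) ℂ) * (ρ (δ * γ)⁻¹ : Matrix (Fin m) (Fin m) ℂ) =
      (ρ δ⁻¹ : Matrix (Fin m) (Fin m) ℂ) := by
    rw [← Submonoid.coe_mul, ← map_mul]
    congr 2
    group
  rw [poincareTerm, poincareTerm, Matrix.mulVec_smul, Matrix.mulVec_mulVec, hρ, hJ, smul_smul,
    mul_smul δ γ z]
  congr 1
  ring

include hD hΓ in
theorem poincareSeries_mem_automorphicForms (hk : 2 ≤ k) :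
    poincareSeries k ρ j p ∈ automorphicForms Γ k ρ := by
  refine ⟨isHolomorphic_poincareSeries hD hΓ k ρ j p hk, fun γ z => ?_⟩
  have h1 := (hasSum_poincareTerm hD hΓ k ρ j p hk (γ • z)).const_smul (jacobian (γ : Aut D) z ^ k)
  simp_rw [jacobian_smul_poincareTerm hD k ρ j p] at h1
  have h2 := (hasSum_poincareTerm hD hΓ k ρ j p hk z).map
    (Matrix.mulVecLin (ρ γ : Matrix (Fin m) (Fin m) ℂ))
    (LinearMap.continuous_of_finiteDimensional _)
  -- Automorphy is the reindexing δ ↦ δγ of the sum.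
  have h3 := (Equiv.mulRight γ).hasSum_iff.2 h2
  exact h1.unique h3

end Series

/-! ### Growth of automorphic forms and unfolding -/

section Petersson

open Metric Set Filter

variable {n m : ℕ} {D : Set (Fin n → ℂ)} (hD : IsBoundedSymmetricDomain D)
  {Γ : Subgroup (Aut D)} (hΓ : IsSmoothCocompactLattice Γ)

theorem sum_norm_sq_mulVec_unitary (U : Matrix.unitaryGroup (Fin m) ℂ) (v : Fin m → ℂ) :
    ∑ i, ‖(U : Matrix (Fin m) (Fin m) ℂ).mulVec v i‖ ^ 2 = ∑ i, ‖v i‖ ^ 2 := by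
  have key : ∀ w : Fin m → ℂ, ((∑ i, ‖w i‖ ^ 2 : ℝ) : ℂ) = dotProduct (star w) w := fun w => by
    rw [dotProduct, Complex.ofReal_sum]
    refine Finset.sum_congr rfl fun i _ => ?_
    rw [Pi.star_apply, ← Complex.normSq_eq_norm_sq, ← Complex.mul_conj, mul_comm]
    rfl
  have hU : (U : Matrix (Fin m) (Fin m) ℂ).conjTranspose * (U : Matrix (Fin m) (Fin m) ℂ) = 1 :=
    Matrix.UnitaryGroup.star_mul_self U
  have h : ((∑ i, ‖(U : Matrix (Fin m) (Fin m) ℂ).mulVec v i‖ ^ 2 : ℝ) : ℂ) =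
      ((∑ i, ‖v i‖ ^ 2 : ℝ) : ℂ) := by
    rw [key, key, Matrix.star_mulVec, ← Matrix.dotProduct_mulVec, Matrix.mulVec_mulVec, hU,
      Matrix.one_mulVec]
  exact_mod_cast h

variable {k : ℕ} {ρ : Γ →* Matrix.unitaryGroup (Fin m) ℂ} {H : D → Fin m → ℂ}

include hD hΓ in
/-- The pointwise Petersson norm of an automorphic form is bounded. -/
theorem exists_norm_sq_le_of_mem_automorphicForms (hH : H ∈ automorphicForms Γ k ρ)
    (j : Fin m) : ∃ M : ℝ, ∀ w, ‖H w j‖ ^ 2 ≤ M * bergmanDiag w ^ k := by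
  have hpos := bergmanDiag_pos hD.isOpen hD.isBounded
  -- Unitarity of ρ and the transformation law of 𝒦 make this function Γ-invariant. It descends to
  -- the compact quotient and is therefore bounded.
  set N : D → ℝ := fun z => (∑ i, ‖H z i‖ ^ 2) * (bergmanDiag z ^ k)⁻¹ with hN
  have hNinv : ∀ (γ : Γ) z, N (γ • z) = N z := by
    intro γ z
    have hJ := norm_pos_iff.2 (jacobian_ne_zero hD.isOpen (γ : Aut D) z)
    have h1 := sum_norm_sq_mulVec_unitary (ρ γ) (H z)
    rw [← hH.2 γ z] at h1
    simp only [Pi.smul_apply, smul_eq_mul, norm_mul, norm_pow, mul_pow, ← Finset.mul_sum] at h1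
    have h2 : bergmanDiag (γ • z) * ‖jacobian (γ : Aut D) z‖ ^ 2 = bergmanDiag z :=
      bergmanDiag_smul hD.isOpen (γ : Aut D) z
    have h3 := (hpos (γ • z)).ne'
    simp only [hN]
    rw [← h1, ← h2, mul_pow]
    field_simp
    rw [← pow_mul, ← pow_mul, mul_comm k 2]
  have hNc : Continuous N := by
    have hHc := hH.1.continuous
    refine Continuous.mul (by fun_prop) ?_
    exact ((continuous_bergmanDiag hD.isOpen).pow k).inv₀ fun z => (pow_pos (hpos z) k).ne'
  have := hΓ.compact
  let Nq : MulAction.orbitRel.Quotient Γ D → ℝ := Quotient.lift N (by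
    rintro a b ⟨γ, rfl⟩
    exact hNinv γ b)
  have hNq : Continuous Nq := hNc.quotient_lift _
  obtain ⟨M, hM⟩ := (isCompact_range hNq).bddAbove
  refine ⟨M, fun w => ?_⟩
  have h1 : N w ≤ M := hM ⟨Quotient.mk _ w, rfl⟩
  rw [hN] at h1
  simp only at h1
  rw [← div_eq_mul_inv, div_le_iff₀ (pow_pos (hpos w) k)] at h1
  exact (Finset.single_le_sum (f := fun i => ‖H w i‖ ^ 2) (fun i _ => sq_nonneg _)
    (Finset.mem_univ j)).trans h1

include hD in
-- Unitarity moves ρ(γ⁻¹) onto H(z) as ρ(γ), automorphy replaces ρ(γ)H(z) by J^k H(γz), and the law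
-- of 𝒦 absorbs |J|^{2k}. What remains depends on γz alone, as unfolding requires.
theorem dotProduct_star_poincareTerm (hH : H ∈ automorphicForms Γ k ρ) (j : Fin m) (p : D)
    (γ : Γ) (z : D) :
    dotProduct (H z) (star (poincareTerm k ρ j p γ z)) * (bergmanKernel D z z ^ k)⁻¹ =
      bergmanConst D k * (H (γ • z) j * bergmanKernel D p (γ • z) ^ k *
        ((bergmanDiag (γ • z) ^ k)⁻¹ : ℝ)) := by
  have hK := isReproducingKernel_bergmanKernel hD.isOpen
  have hpos := bergmanDiag_pos hD.isOpen hD.isBounded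
  have hinv : (ρ γ⁻¹ : Matrix (Fin m) (Fin m) ℂ) =
      (ρ γ : Matrix (Fin m) (Fin m) ℂ).conjTranspose := by
    rw [map_inv]
    rfl
  have h1 : dotProduct (H z) (star (poincareTerm k ρ j p γ z)) =
      bergmanConst D k * conj (jacobian (γ : Aut D) z) ^ k *
        (jacobian (γ : Aut D) z ^ k * H (γ • z) j * bergmanKernel D p (γ • z) ^ k) := by
    rw [poincareTerm, star_smul, dotProduct_smul, hinv, Matrix.star_mulVec,
      Matrix.conjTranspose_conjTranspose, dotProduct_comm, ← Matrix.dotProduct_mulVec,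
      ← hH.2 γ z, seed, ← Pi.single_star, single_dotProduct, hK.hermitian p]
    simp only [Pi.smul_apply, smul_eq_mul, RCLike.star_def, map_mul, map_pow, Complex.conj_ofReal]
    ring
  have h2 : bergmanKernel D z z =
      bergmanDiag (γ • z) * (jacobian (γ : Aut D) z * conj (jacobian (γ : Aut D) z)) := by
    have : bergmanDiag (γ • z) * ‖jacobian (γ : Aut D) z‖ ^ 2 = bergmanDiag z :=
      bergmanDiag_smul hD.isOpen (γ : Aut D) z
    rw [Complex.mul_conj, Complex.normSq_eq_norm_sq, ← ofReal_bergmanDiag hD.isOpen, ← this]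
    push_cast
    rfl
  have hJ := jacobian_ne_zero hD.isOpen (γ : Aut D) z
  have hJ' : conj (jacobian (γ : Aut D) z) ≠ 0 := (map_ne_zero _).2 hJ
  have hκ : (bergmanDiag (γ • z) : ℂ) ≠ 0 := Complex.ofReal_ne_zero.2 (hpos _).ne'
  rw [h1, h2]
  push_cast
  rw [mul_pow, mul_pow]
  field_simp

include hD in
theorem smulInvariantMeasure_invVolume : SMulInvariantMeasure Γ D (invVolume D) := by
  refine ⟨fun γ s hs => ?_⟩
  have h := (quasiInvariant_invVolume hD.isOpen hD.isBounded).measurePreserving hD.isOpen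
    (γ : Aut D)
  simp only [pow_zero] at h
  rw [show (fun _ : D => (1 : ℝ≥0∞)) = 1 from rfl, withDensity_one] at h
  exact h.measure_preimage hs.nullMeasurableSet

include hD hΓ in
/-- Unfolding of the Petersson product with the Poincaré series. -/
theorem petersson_poincareSeries (hk : 2 ≤ k) (hH : H ∈ automorphicForms Γ k ρ) (j : Fin m)
    (p : D) {𝓕 : Set D} (h𝓕 : IsFundamentalDomain Γ 𝓕 (invVolume D)) :
    IntegrableOn (peterssonDensity k H (poincareSeries k ρ j p)) 𝓕 (invVolume D) ∧
      petersson 𝓕 k H (poincareSeries k ρ j p) = H p j := by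
  have := hΓ.discrete
  have : Countable Γ := countable_of_discrete hD.isOpen
  have : SMulInvariantMeasure Γ D (invVolume D) := smulInvariantMeasure_invVolume hD
  have : MeasurableConstSMul Γ D := ⟨fun γ => (continuous_aut_smul (γ : Aut D)).measurable⟩
  have hHj : IsHolomorphic fun w => H w j := isHolomorphic_pi.1 hH.1 j
  obtain ⟨M, hM⟩ := exists_norm_sq_le_of_mem_automorphicForms hD hΓ hH j
  set Φ : D → ℂ := fun w => bergmanConst D k * (H w j * bergmanKernel D p w ^ k *
    ((bergmanDiag w ^ k)⁻¹ : ℝ)) with hΦ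
  have hΦi : Integrable Φ (invVolume D) :=
    (integrable_mul_bergmanKernel_pow hD hk hHj hM p).const_mul _
  have hdens : ∀ z, HasSum (fun γ : Γ => Φ (γ • z))
      (peterssonDensity k H (poincareSeries k ρ j p) z) := by
    intro z
    have h1 := hasSum_poincareTerm hD hΓ k ρ j p hk z
    have h2 : Continuous fun v : Fin m → ℂ =>
        dotProduct (H z) (star v) * (bergmanKernel D z z ^ k)⁻¹ := by
      simp only [dotProduct, Pi.star_apply]
      fun_prop
    have h3 := h1.map (AddMonoidHom.mk' (fun v : Fin m → ℂ =>
      dotProduct (H z) (star v) * (bergmanKernel D z z ^ k)⁻¹) fun v w => by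
        rw [star_add, dotProduct_add, add_mul]) h2
    simp only [Function.comp_def, AddMonoidHom.mk'_apply,
      dotProduct_star_poincareTerm hD hH j p] at h3
    exact h3
  have hΦm : ∀ γ : Γ, AEStronglyMeasurable (fun z => Φ (γ • z)) ((invVolume D).restrict 𝓕) :=
    fun γ => (hΦi.aestronglyMeasurable.comp_measurePreserving
      (measurePreserving_smul γ (invVolume D))).restrict
  -- By unfolding, this sum is the integral of |Φ| over D. Its finiteness gives integrability on 𝓕
  -- and allows exchanging sum and integral.
  have hfin : ∑' γ : Γ, ∫⁻ z in 𝓕, ‖Φ (γ • z)‖ₑ ∂(invVolume D) ≠ ∞ := by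
    rw [← h𝓕.lintegral_eq_tsum'' fun z => ‖Φ z‖ₑ]
    exact hΦi.2.ne
  have hdens' : peterssonDensity k H (poincareSeries k ρ j p) = fun z => ∑' γ : Γ, Φ (γ • z) :=
    funext fun z => (hdens z).tsum_eq.symm
  have hcont : Continuous (peterssonDensity k H (poincareSeries k ρ j p)) := by
    have hd : Continuous fun z => bergmanKernel D z z :=
      (isReproducingKernel_bergmanKernel hD.isOpen).continuous_diag hD.isOpen
        (evalBounded_eucVolume hD.isOpen)
    have h1 := hH.1.continuous
    have h2 := (isHolomorphic_poincareSeries hD hΓ k ρ j p hk).continuous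
    refine Continuous.mul ?_ ((hd.pow k).inv₀ fun z => ?_)
    · simp only [dotProduct, Pi.star_apply]
      fun_prop
    · rw [Pi.pow_apply, ← ofReal_bergmanDiag hD.isOpen]
      exact pow_ne_zero k (Complex.ofReal_ne_zero.2
        (bergmanDiag_pos hD.isOpen hD.isBounded z).ne')
  refine ⟨⟨hcont.aestronglyMeasurable, ?_⟩, ?_⟩
  · refine lt_of_le_of_lt (lintegral_mono fun z => ?_)
      ((lintegral_tsum fun γ => (hΦm γ).enorm).trans_lt hfin.lt_top)
    rw [hdens']
    exact enorm_tsum_le_tsum_enorm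
  · rw [petersson, hdens', integral_tsum hΦm hfin, ← h𝓕.integral_eq_tsum'' Φ hΦi, hΦ,
      integral_const_mul, reproducing_of_norm_sq_le hD hk hHj hM p]

end Petersson

end PoincareSeries

theorem proposition3p2 {n : ℕ} (hn : 1 ≤ n) (D : Set (Fin n → ℂ))
    (hD : PoincareSeries.IsBoundedSymmetricDomain D)
    (Γ : Subgroup (PoincareSeries.Aut D)) (hΓ : PoincareSeries.IsSmoothCocompactLattice Γ)
    {m : ℕ} (ρ : Γ →* Matrix.unitaryGroup (Fin m) ℂ) :
    ∃ k₀ : ℕ, ∀ k : ℕ, k₀ ≤ k → ∀ (j : Fin m) (p : D),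
      -- absolute and uniform convergence on compact sets, with sum `Θ_p^{(j;k)}`
      (∀ A : Set D, IsCompact A →
        SummableUniformlyOn
          (fun (γ : Γ) (z : D) => ‖PoincareSeries.poincareTerm k ρ j p γ z‖) A ∧
        HasSumUniformlyOn (fun (γ : Γ) (z : D) => PoincareSeries.poincareTerm k ρ j p γ z)
          (PoincareSeries.poincareSeries k ρ j p) A) ∧
      -- `Θ_p^{(j;k)}` is an automorphic form, and its inner products reproduce the values at `p`
      PoincareSeries.poincareSeries k ρ j p ∈ PoincareSeries.automorphicForms Γ k ρ ∧
      (∃ 𝓕 : Set D,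
        MeasureTheory.IsFundamentalDomain Γ 𝓕 (PoincareSeries.invVolume D)) ∧
      ∀ 𝓕 : Set D,
        MeasureTheory.IsFundamentalDomain Γ 𝓕 (PoincareSeries.invVolume D) →
        ∀ H ∈ PoincareSeries.automorphicForms Γ k ρ,
          MeasureTheory.IntegrableOn
            (PoincareSeries.peterssonDensity k H (PoincareSeries.poincareSeries k ρ j p)) 𝓕
            (PoincareSeries.invVolume D) ∧
          PoincareSeries.petersson 𝓕 k H (PoincareSeries.poincareSeries k ρ j p) = H p j := by
  -- The value 2 serves both convergence, where two factors are summed, and the domination of the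
  -- reproducing integrand by β.
  refine ⟨2, fun k hk j p => ⟨fun A hA => ⟨?_, ?_⟩, ?_, ?_, fun 𝓕 h𝓕 H hH => ?_⟩⟩
  · exact PoincareSeries.summableUniformlyOn_norm_poincareTerm hD hΓ k ρ j p hk hA
  · exact PoincareSeries.hasSumUniformlyOn_poincareTerm hD hΓ k ρ j p hk hA
  · exact PoincareSeries.poincareSeries_mem_automorphicForms hD hΓ k ρ j p hk
  · exact PoincareSeries.exists_isFundamentalDomain hD hΓ _
  · exact PoincareSeries.petersson_poincareSeries hD hΓ hk hH j p h𝓕
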